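/- A seller offers one good to a single buyer whose value $v\in[a,b]$ (where $a<b$ and $b\ge 0$) has distribution function $F$ with density $f$ on $[a,b]$. Assume that $f$ is log-concave and twice continuously differentiable on $[a,b]$ and strictly positive on $[a,b)$. The seller observes a signal $s\in[a,b]$ which equals $v$ with probability $1-\gamma$ and is otherwise an independent draw from $F$, where $\gamma\in(0,1)$; given $s$, the posterior law of $v$ is $\gamma F+(1-\gamma)\delta_s$. A signal-revealing direct mechanism consists of an allocation probability $x(\theta,s)\in[0,1]$ and a payment $t(\theta,s)$ that, for each signal $s$, satisfy, for all $\theta,\theta'\in[a,b]$, incentive compatibility $\theta x(\theta,s)-t(\theta,s)\ge\theta x(\theta',s)-t(\theta',s)$ and individual rationality $\theta x(\theta,s)-t(\theta,s)\ge 0$. It is optimal if for every $s\in[a,b]$ it maximizes the posterior expected payment among all such mechanisms. Posting a price $p(s)$ means $x(\theta,s)=1$ and $t(\theta,s)=p(s)$ if $\theta\ge p(s)$, and $x(\theta,s)=t(\theta,s)=0$ otherwise. Let $$\varphi_F(v)=v-\frac{1-F(v)}{f(v)},\qquad \varphi_{\gamma F}(v)=v-\frac{1/\gamma-F(v)}{f(v)},\qquad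 u(v)=v\,(1-\gamma F(v))$$ (if $f(b)=0$, the two fractions are read as $0$ at $v=b$; this does not affect the quantities below). The infimum (supremum) of the empty subset of $[a,b]$ is $b$ (resp. $a$). *The threshold $T_s$.* Let $H_F(x)=\int_a^x t\,dF(t)-\int_a^x(1-F(t))\,dt-a$, let $\Psi_F(x)=\sup\{\alpha+\beta F(x):\alpha,\beta\in\mathbb R,\ \alpha+\beta F(y)\le H_F(y)\ \forall y\in[a,b]\}$, let $\ell_F(x)$ be the infimum of the set of all $\beta$ with $\Psi_F(z)\ge\Psi_F(x)+\beta(F(z)-F(x))$ for all $z\in[a,b]$, and let $\alpha_F(x)=\Psi_F(x)-\ell_F(x)F(x)$. Put $$\mu_s(x)=\gamma\alpha_F(x)-(1-\gamma)\ell_F(x)+\gamma\,\ell_F(x)F(s)-\gamma H_F(s)+(1-\gamma)s .$$ For $s\in[a,b)$, $T_s$ is the smallest $T\in(s,b]$ with $\mu_s(T)=0$, and $T_b=b$. *Thresholds.* Let $p^{\mathrm{ignore}}=\inf\{v\in[a,b]:\varphi_F(v)\ge0\}$, $C_\gamma=\sup\{v\in[a,b]:\varphi_{\gamma F}(v)<0\}$,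 $$p^{\mathrm{cap}}=M_\gamma=\begin{cases}\inf\{v\in[a,b]:\varphi_{\gamma F}(v)\ge0\}&\text{if }\varphi_{\gamma F}(a)<0,\\ C_\gamma&\text{if }\varphi_{\gamma F}(a)\ge0\text{ and }u(a)\le u(C_\gamma),\\ a&\text{otherwise,}\end{cases}$$ $$L_\gamma=\begin{cases}\inf\{s\in[a,b]:T_s\ge p^{\mathrm{ignore}}\}&\text{if }\varphi_{\gamma F}(a)<0,\\ \min\bigl(\inf\{v\in[a,b]:u(v)>u(a)\},\,M_\gamma\bigr)&\text{otherwise,}\end{cases}$$ $$U_\gamma=\sup\{s\in[a,b]:u(s)\le u(M_\gamma)\}.$$ Then $L_\gamma\le M_\gamma\le U_\gamma$, and posting the price $$p^*(s)=\begin{cases}p^{\mathrm{ignore}},&s<L_\gamma,\\ s,&L_\gamma\le s<M_\gamma,\\ p^{\mathrm{cap}},&M_\gamma\le s\le U_\gamma,\\ s,&s>U_\gamma\end{cases}$$ is an optimal signal-revealing mechanism. In particular, if $a=0$, the same holds with $p^{\mathrm{cap}}=M_\gamma=\inf\{v\in[0,b]:\varphi_{\gamma F}(v)\ge0\}$, $L_\gamma=\inf\{s\in[0,b]:T_s\ge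 p^{\mathrm{ignore}}\}$ and $U_\gamma=\sup\{s\in[0,b]:u(s)\le u(M_\gamma)\}$. -/

import Mathlib

open Set MeasureTheory

namespace HallucinatedSignal

noncomputable section

/-- `f` is log-concave on the convex set `S`. -/
def LogConcaveOn (S : Set ℝ) (f : ℝ → ℝ) : Prop :=
  Convex ℝ S ∧ ∀ x ∈ S, ∀ y ∈ S, ∀ p q : ℝ, 0 ≤ p → 0 ≤ q → p + q = 1 →
    f x ^ p * f y ^ q ≤ f (p * x + q * y)

/-! ### The prior and the posterior -/

/-- The law of the buyer's value: the distribution on `[a, b]` with density `f`. -/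
def prior (a b : ℝ) (f : ℝ → ℝ) : Measure ℝ :=
  (volume.restrict (Icc a b)).withDensity (fun v => ENNReal.ofReal (f v))

/-- The cumulative distribution function `F` of the prior, on `[a, b]`. -/
def priorCDF (a : ℝ) (f : ℝ → ℝ) (v : ℝ) : ℝ := ∫ t in a..v, f t

/-- The posterior law of the value given the signal `s`: with probability `γ` the signal is a
hallucination and the value is distributed as the prior, otherwise the value is `s`. -/
def posterior (a b : ℝ) (f : ℝ → ℝ) (γ s : ℝ) : Measure ℝ :=
  ENNReal.ofReal γ • prior a b f + ENNReal.ofReal (1 - γ) • Measure.dirac s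

/-! ### Signal-revealing direct mechanisms for one buyer -/

/-- A direct mechanism: probability of allocation and payment, as functions of the reported
value and of the signal (in this order). -/
structure Mechanism where
  alloc : ℝ → ℝ → ℝ
  pay : ℝ → ℝ → ℝ

/-- Utility of a buyer of value `θ` who reports `θ'` when the signal is `s`. -/
def Mechanism.utility (m : Mechanism) (s θ θ' : ℝ) : ℝ := θ * m.alloc θ' s - m.pay θ' s

/-- Feasibility at the signal `s`: allocation probabilities, incentive compatibility and
individual rationality. -/
structure Mechanism.FeasibleAt (m : Mechanism) (a b s : ℝ) : Prop where
  alloc_nonneg : ∀ θ ∈ Icc a b, 0 ≤ m.alloc θ s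
  alloc_le_one : ∀ θ ∈ Icc a b, m.alloc θ s ≤ 1
  incentive_compatible :
    ∀ θ ∈ Icc a b, ∀ θ' ∈ Icc a b, m.utility s θ θ' ≤ m.utility s θ θ
  individually_rational : ∀ θ ∈ Icc a b, 0 ≤ m.utility s θ θ

/-- Expected payment under the posterior given the signal `s`. For a feasible mechanism the payment
is a bounded measurable function of the report on `[a, b]`, so that this integral converges. -/
def Mechanism.revenue (m : Mechanism) (a b : ℝ) (f : ℝ → ℝ) (γ s : ℝ) : ℝ :=
  ∫ θ, m.pay θ s ∂(posterior a b f γ s)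

/-- `m` is an optimal signal-revealing mechanism: for every signal it is feasible and maximizes
the posterior expected revenue among all mechanisms that are feasible at that signal. -/
def Mechanism.IsOptimal (m : Mechanism) (a b : ℝ) (f : ℝ → ℝ) (γ : ℝ) : Prop :=
  ∀ s ∈ Icc a b, m.FeasibleAt a b s ∧
    ∀ m' : Mechanism, m'.FeasibleAt a b s → m'.revenue a b f γ s ≤ m.revenue a b f γ s

open Classical in
/-- The mechanism that posts the price `price s` when the signal is `s`. -/
def postedPrice (price : ℝ → ℝ) : Mechanism where
  alloc θ s := if price s ≤ θ then 1 else 0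
  pay θ s := if price s ≤ θ then price s else 0

/-! ### Virtual values and the revenue curve -/

/-- The virtual value `φ_G` of a (sub-)distribution function `G` with density `g`. -/
def virtualValue (G g : ℝ → ℝ) (v : ℝ) : ℝ := v - (1 - G v) / g v

/-- `φ_F`. -/
def phiF (a : ℝ) (f : ℝ → ℝ) (v : ℝ) : ℝ := virtualValue (priorCDF a f) f v

/-- `φ_{γF}`. -/
def phiGammaF (a : ℝ) (f : ℝ → ℝ) (γ v : ℝ) : ℝ :=
  virtualValue (fun t => γ * priorCDF a f t) (fun t => γ * f t) v

/-- The revenue curve `v (1 - γ F(v))`. -/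
def revCurve (a : ℝ) (f : ℝ → ℝ) (γ v : ℝ) : ℝ := v * (1 - γ * priorCDF a f v)

open Classical in
/-- Infimum of a subset of `[a, b]`; the infimum of the empty set is `b`. -/
def infOr (b : ℝ) (S : Set ℝ) : ℝ := if S.Nonempty then sInf S else b

open Classical in
/-- Supremum of a subset of `[a, b]`; the supremum of the empty set is `a`. -/
def supOr (a : ℝ) (S : Set ℝ) : ℝ := if S.Nonempty then sSup S else a

/-! ### The threshold `T_s` -/

/-- `H_F(x) = ∫_a^x t dF(t) - ∫_a^x (1 - F(t)) dt - a`. -/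
def HF (a : ℝ) (f : ℝ → ℝ) (x : ℝ) : ℝ :=
  (∫ t in a..x, t * f t) - (∫ t in a..x, (1 - priorCDF a f t)) - a

/-- `Ψ_F`, the generalized convex hull of `H_F`: the supremum at `x` of the affine functions of
`F` that lie below `H_F` on `[a, b]`. -/
def PsiF (a b : ℝ) (f : ℝ → ℝ) (x : ℝ) : ℝ :=
  sSup {r : ℝ | ∃ α β : ℝ, (∀ y ∈ Icc a b, α + β * priorCDF a f y ≤ HF a f y) ∧
    r = α + β * priorCDF a f x}

/-- The generalized subdifferential of `Ψ_F` at `x`. -/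
def subdiffPsiF (a b : ℝ) (f : ℝ → ℝ) (x : ℝ) : Set ℝ :=
  {β : ℝ | ∀ z ∈ Icc a b,
    PsiF a b f x + β * (priorCDF a f z - priorCDF a f x) ≤ PsiF a b f z}

/-- `ℓ_F(x)`, the least generalized subgradient of `Ψ_F` at `x`. -/
def ellF (a b : ℝ) (f : ℝ → ℝ) (x : ℝ) : ℝ := sInf (subdiffPsiF a b f x)

/-- The `α` for which `(α, ℓ_F(x))` is optimal in the problem that defines `Ψ_F(x)`. -/
def alphaF (a b : ℝ) (f : ℝ → ℝ) (x : ℝ) : ℝ :=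
  PsiF a b f x - ellF a b f x * priorCDF a f x

/-- `μ_y(x) = α̂ + γ β̂ F(y) - γ H_F(y) + (1 - γ) y`, where `β̂ = ℓ_F(x)` and
`α̂ = γ α - (1 - γ) ℓ_F(x)`. -/
def mu (a b : ℝ) (f : ℝ → ℝ) (γ y x : ℝ) : ℝ :=
  (γ * alphaF a b f x - (1 - γ) * ellF a b f x) + γ * ellF a b f x * priorCDF a f y
    - γ * HF a f y + (1 - γ) * y

/-- `T_s`, the smallest zero of `μ_s` in `(s, b]` (for `s = b` this interval is empty, and
`T_b = b`). -/
def thresholdT (a b : ℝ) (f : ℝ → ℝ) (γ s : ℝ) : ℝ :=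
  infOr b {T : ℝ | T ∈ Ioc s b ∧ mu a b f γ s T = 0}

/-! ### The prices and the regime boundaries -/

/-- The monopoly price of the prior. -/
def pIgnore (a b : ℝ) (f : ℝ → ℝ) : ℝ := infOr b {v : ℝ | v ∈ Icc a b ∧ 0 ≤ phiF a f v}

/-- The first point of `[a, b]` where `φ_{γF}` is nonnegative. -/
def firstNonneg (a b : ℝ) (f : ℝ → ℝ) (γ : ℝ) : ℝ :=
  infOr b {v : ℝ | v ∈ Icc a b ∧ 0 ≤ phiGammaF a f γ v}

/-- `inf {s ∈ [a, b] : T_s ≥ p^ignore}`. -/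
def firstFollow (a b : ℝ) (f : ℝ → ℝ) (γ : ℝ) : ℝ :=
  infOr b {s : ℝ | s ∈ Icc a b ∧ pIgnore a b f ≤ thresholdT a b f γ s}

/-- `sup {s ∈ [a, b] : s (1 - γ F(s)) ≤ M (1 - γ F(M))}`. -/
def capEnd (a b : ℝ) (f : ℝ → ℝ) (γ M : ℝ) : ℝ :=
  supOr a {s : ℝ | s ∈ Icc a b ∧ revCurve a f γ s ≤ revCurve a f γ M}

/-- `C_γ = sup {v ∈ [a, b] : φ_{γF}(v) < 0}`. -/
def CGamma (a b : ℝ) (f : ℝ → ℝ) (γ : ℝ) : ℝ :=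
  supOr a {v : ℝ | v ∈ Icc a b ∧ phiGammaF a f γ v < 0}

open Classical in
/-- The cap price, for a general lower end `a` of the support. -/
def pCap (a b : ℝ) (f : ℝ → ℝ) (γ : ℝ) : ℝ :=
  if phiGammaF a f γ a < 0 then firstNonneg a b f γ
  else if revCurve a f γ a ≤ revCurve a f γ (CGamma a b f γ) then CGamma a b f γ
  else a

open Classical in
/-- `L_γ`, for a general lower end `a` of the support. -/
def LGamma (a b : ℝ) (f : ℝ → ℝ) (γ : ℝ) : ℝ :=
  if phiGammaF a f γ a < 0 then firstFollow a b f γ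
  else min (infOr b {v : ℝ | v ∈ Icc a b ∧ revCurve a f γ a < revCurve a f γ v}) (pCap a b f γ)

open Classical in
/-- The price that ignores signals below `L`, follows signals in `[L, M)`, is capped for signals
in `[M, U]`, and follows signals above `U`. -/
def fourRegimePrice (ignore cap L M U s : ℝ) : ℝ :=
  if s < L then ignore else if s < M then s else if s ≤ U then cap else s

/-- The ordering of the regime boundaries, and the optimality of posting the four-regime price. -/
def FourRegimeOptimal (a b : ℝ) (f : ℝ → ℝ) (γ ignore cap L M U : ℝ) : Prop :=
  (L ≤ M ∧ M ≤ U) ∧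
    (postedPrice (fourRegimePrice ignore cap L M U)).IsOptimal a b f γ

end

end HallucinatedSignal

namespace HallucinatedSignal

open Filter Topology

/-! ### Log-concave functions -/

/-! Fix a signal `s` and write `u_c(p) = p (1 - c F(p))`, which is `revCurve a f c p`. A price `p ≤
s` also sells to the buyer whose signal is truthful and earns `u_γ(p)`; a price `p > s` earns `γ
u_1(p)`. Slicing an allocation into its superlevel sets makes any feasible mechanism earn at most an
average of posted-price revenues (`FeasibleAt.pay_le`, `FeasibleAt.integral_pay_le`, `revenue_le`).
So only `u_γ` on `[a, s]` and `γ u_1` on `[s, b]` have to be compared.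

Log-concavity controls both curves. It makes the inverse hazard rate antitone, so `φ_F` is strictly
increasing and `u_1` is single-peaked at `pIgnore`. Then `H_F = -u_1` is convex as a function of
`F`, hence equal to its hull, with least subgradient `φ_F` on `(a, b]`. This makes `μ_s` explicit,
and for `s < pIgnore` the condition `pIgnore ≤ T_s` becomes `γ u_1(pIgnore) ≤ u_γ(s)`
(`pIgnore_le_thresholdT_iff`). The curve `u_γ` need not be single-peaked, but once it has stopped
increasing and then increases again, it increases up to `b` (`marginal_neg_of_lt`). Past a point `x`
where it does not increase, `u_γ` on `[x, s]` is therefore at most the larger of its two end values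
(`revCurve_le_max`). The price regimes follow by comparing the candidates `pIgnore`, `M` and `s`. -/

theorem LogConcaveOn.cross_mul_le {S : Set ℝ} {f : ℝ → ℝ} (hf : LogConcaveOn S f)
    (hnn : ∀ x ∈ S, 0 ≤ f x) {x y h : ℝ} (hxy : x ≤ y) (hh : 0 ≤ h) (hx : x ∈ S)
    (hy : y + h ∈ S) : f x * f (y + h) ≤ f (x + h) * f y := by
  rcases eq_or_lt_of_le hh with rfl | hh'
  · simp
  have hd : 0 < y + h - x := by linarith
  -- Both inner points `y` and `x + h` are convex combinations of `x` and `y + h`, with the same two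
  -- weights interchanged; multiplying the two log-concavity inequalities recombines the exponents
  -- to `1`.
  set p : ℝ := h / (y + h - x) with hp
  set q : ℝ := (y - x) / (y + h - x) with hq
  have hp0 : 0 ≤ p := by positivity
  have hq0 : 0 ≤ q := div_nonneg (by linarith) hd.le
  have hpq : p + q = 1 := by rw [hp, hq]; field_simp; ring
  have e1 : p * x + q * (y + h) = y := by rw [hp, hq]; field_simp; ring
  have e2 : q * x + p * (y + h) = x + h := by rw [hp, hq]; field_simp; ring
  have h1 := hf.2 x hx (y + h) hy p q hp0 hq0 hpq
  have h2 := hf.2 x hx (y + h) hy q p hq0 hp0 (by linarith)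
  rw [e1] at h1
  rw [e2] at h2
  have A := hnn x hx
  have B := hnn _ hy
  have e3 : f x = f x ^ p * f x ^ q := by
    rw [← Real.rpow_add_of_nonneg A hp0 hq0, hpq, Real.rpow_one]
  have e4 : f (y + h) = f (y + h) ^ q * f (y + h) ^ p := by
    rw [← Real.rpow_add_of_nonneg B hq0 hp0, add_comm q p, hpq, Real.rpow_one]
  calc f x * f (y + h)
      = (f x ^ q * f (y + h) ^ p) * (f x ^ p * f (y + h) ^ q) := by
        conv_lhs => rw [e3, e4]
        ring
    _ ≤ f (x + h) * f y :=
        mul_le_mul h2 h1 (mul_nonneg (Real.rpow_nonneg A _) (Real.rpow_nonneg B _))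
          (le_trans (mul_nonneg (Real.rpow_nonneg A _) (Real.rpow_nonneg B _)) h2)

/-- A log-concave density on `[a, b]` that is positive on `[a, b)`. -/
structure IsRegularDensity (a b : ℝ) (f : ℝ → ℝ) : Prop where
  lt : a < b
  pos : ∀ v ∈ Ico a b, 0 < f v
  smooth : ContDiffOn ℝ 2 f (Icc a b)
  logConcave : LogConcaveOn (Icc a b) f
  integral_eq_one : ∫ v in a..b, f v = 1

namespace IsRegularDensity

variable {a b : ℝ} {f : ℝ → ℝ}

theorem continuousOn (hf : IsRegularDensity a b f) : ContinuousOn f (Icc a b) :=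
  hf.smooth.continuousOn

theorem nonneg (hf : IsRegularDensity a b f) : ∀ x ∈ Icc a b, 0 ≤ f x := by
  have h : closure (Ico a b) = Icc a b := closure_Ico hf.lt.ne
  intro x hx
  have hcl : x ∈ closure (Ico a b) := h ▸ hx
  have hc : ContinuousWithinAt f (Ico a b) x := (hf.continuousOn x hx).mono Ico_subset_Icc_self
  have := mem_closure_iff_nhdsWithin_neBot.1 hcl
  exact ge_of_tendsto hc.tendsto
    (eventually_of_mem self_mem_nhdsWithin fun y hy => (hf.pos y hy).le)

theorem intervalIntegrable (hf : IsRegularDensity a b f) {x y : ℝ} (hx : x ∈ Icc a b)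
    (hy : y ∈ Icc a b) : IntervalIntegrable f volume x y :=
  (hf.continuousOn.mono (uIcc_subset_Icc hx hy)).intervalIntegrable

theorem left_mem (hf : IsRegularDensity a b f) : a ∈ Icc a b := left_mem_Icc.2 hf.lt.le

theorem right_mem (hf : IsRegularDensity a b f) : b ∈ Icc a b := right_mem_Icc.2 hf.lt.le

theorem differentiableAt (hf : IsRegularDensity a b f) {x : ℝ} (hx : x ∈ Ioo a b) :
    DifferentiableAt ℝ f x :=
  ((hf.smooth.differentiableOn (by norm_num)) x (Ioo_subset_Icc_self hx)).differentiableAt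
    (Icc_mem_nhds hx.1 hx.2)

/-! ### The distribution function -/

theorem priorCDF_left : priorCDF a f a = 0 := by simp [priorCDF]

theorem priorCDF_right (hf : IsRegularDensity a b f) : priorCDF a f b = 1 := hf.integral_eq_one

theorem priorCDF_sub (hf : IsRegularDensity a b f) {x y : ℝ} (hx : x ∈ Icc a b)
    (hy : y ∈ Icc a b) : priorCDF a f y - priorCDF a f x = ∫ t in x..y, f t :=
  intervalIntegral.integral_interval_sub_left (hf.intervalIntegrable hf.left_mem hy)
    (hf.intervalIntegrable hf.left_mem hx)

theorem continuousOn_priorCDF (hf : IsRegularDensity a b f) :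
    ContinuousOn (priorCDF a f) (Icc a b) := by
  have := intervalIntegral.continuousOn_primitive_interval (μ := volume) (f := f) (a := a) (b := b)
    (by rw [uIcc_of_le hf.lt.le]; exact hf.continuousOn.integrableOn_Icc)
  rwa [uIcc_of_le hf.lt.le] at this

theorem hasDerivAt_priorCDF (hf : IsRegularDensity a b f) {x : ℝ} (hx : x ∈ Ioo a b) :
    HasDerivAt (priorCDF a f) (f x) x := by
  have hn : Icc a b ∈ 𝓝 x := Icc_mem_nhds hx.1 hx.2
  exact intervalIntegral.integral_hasDerivAt_right
    (hf.intervalIntegrable hf.left_mem (Ioo_subset_Icc_self hx))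
    ((hf.continuousOn.mono Ioo_subset_Icc_self).stronglyMeasurableAtFilter isOpen_Ioo x hx)
    (hf.continuousOn.continuousAt hn)

theorem strictMonoOn_priorCDF (hf : IsRegularDensity a b f) :
    StrictMonoOn (priorCDF a f) (Icc a b) := by
  refine strictMonoOn_of_deriv_pos (convex_Icc a b) hf.continuousOn_priorCDF fun x hx => ?_
  rw [interior_Icc] at hx
  rw [(hf.hasDerivAt_priorCDF hx).deriv]
  exact hf.pos x (Ioo_subset_Ico_self hx)

theorem priorCDF_nonneg (hf : IsRegularDensity a b f) {x : ℝ} (hx : x ∈ Icc a b) :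
    0 ≤ priorCDF a f x := by
  rw [← priorCDF_left (a := a) (f := f)]
  exact hf.strictMonoOn_priorCDF.monotoneOn hf.left_mem hx hx.1

theorem priorCDF_le_one (hf : IsRegularDensity a b f) {x : ℝ} (hx : x ∈ Icc a b) :
    priorCDF a f x ≤ 1 := by
  rw [← hf.priorCDF_right]
  exact hf.strictMonoOn_priorCDF.monotoneOn hx hf.right_mem hx.2

/-! ### The inverse hazard rate -/

/-- Integrate `f x * f (y + h) ≤ f (x + h) * f y` over `h ∈ [0, b - y]`. -/
theorem tail_mul_le (hf : IsRegularDensity a b f) {x y : ℝ} (hx : x ∈ Icc a b)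
    (hy : y ∈ Icc a b) (hxy : x ≤ y) :
    f x * (1 - priorCDF a f y) ≤ f y * (priorCDF a f (x + (b - y)) - priorCDF a f x) := by
  have hz : x + (b - y) ∈ Icc a b := ⟨by linarith [hx.1, hy.2], by linarith⟩
  have e1 : 1 - priorCDF a f y = ∫ h in (0 : ℝ)..(b - y), f (y + h) := by
    rw [← hf.priorCDF_right, hf.priorCDF_sub hy hf.right_mem,
      intervalIntegral.integral_comp_add_left (fun t => f t)]
    simp
  have e2 : priorCDF a f (x + (b - y)) - priorCDF a f x = ∫ h in (0 : ℝ)..(b - y), f (x + h) := by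
    rw [hf.priorCDF_sub hx hz, intervalIntegral.integral_comp_add_left (fun t => f t)]
    simp
  have hby : 0 ≤ b - y := by linarith [hy.2]
  have i : ∀ w ∈ Icc a b, w + (b - y) ∈ Icc a b →
      IntervalIntegrable (fun h => f (w + h)) volume 0 (b - y) := by
    intro w hw hw'
    refine ContinuousOn.intervalIntegrable_of_Icc hby ?_
    refine hf.continuousOn.comp (by fun_prop) fun h hh => ?_
    exact ⟨by linarith [hw.1, hh.1], by linarith [hw'.2, hh.2]⟩
  rw [e1, e2, ← intervalIntegral.integral_const_mul, ← intervalIntegral.integral_const_mul]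
  refine intervalIntegral.integral_mono_on hby
    ((i y hy (by simpa using hf.right_mem)).const_mul _) ((i x hx hz).const_mul _) fun h hh => ?_
  have := hf.logConcave.cross_mul_le hf.nonneg hxy hh.1 hx
    (⟨by linarith [hy.1, hh.1], by linarith [hh.2]⟩ : y + h ∈ Icc a b)
  linarith [mul_comm (f (x + h)) (f y)]

/-- Keeping `F (x + (b - y))` instead of bounding it by `1` gives a right side that tends to `0` as
`y → b`. This yields continuity of `φ_F` at `b` even when `f b = 0`. -/
theorem invHazard_le (hf : IsRegularDensity a b f) {x y : ℝ} (hx : x ∈ Ico a b)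
    (hy : y ∈ Icc a b) (hxy : x ≤ y) :
    (1 - priorCDF a f y) / f y ≤ (priorCDF a f (x + (b - y)) - priorCDF a f x) / f x := by
  have hx' := Ico_subset_Icc_self hx
  have hz : x + (b - y) ∈ Icc a b := ⟨by linarith [hx.1, hy.2], by linarith⟩
  have h := hf.tail_mul_le hx' hy hxy
  have hpx := hf.pos x hx
  rcases (hf.nonneg y hy).eq_or_lt with h0 | h0
  · rw [← h0, div_zero]
    refine div_nonneg (sub_nonneg.2 ?_) hpx.le
    exact hf.strictMonoOn_priorCDF.monotoneOn hx' hz (by linarith [hy.2])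
  · rw [div_le_div_iff₀ h0 hpx]
    linarith

theorem invHazard_antitone (hf : IsRegularDensity a b f) {x y : ℝ} (hx : x ∈ Ico a b)
    (hy : y ∈ Icc a b) (hxy : x ≤ y) :
    (1 - priorCDF a f y) / f y ≤ (1 - priorCDF a f x) / f x := by
  have hz : x + (b - y) ∈ Icc a b := ⟨by linarith [hx.1, hy.2], by linarith⟩
  refine (hf.invHazard_le hx hy hxy).trans ?_
  have := hf.priorCDF_le_one hz
  have := hf.pos x hx
  gcongr

/-! ### The virtual value -/

theorem phiF_strictMonoOn (hf : IsRegularDensity a b f) :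
    StrictMonoOn (phiF a f) (Icc a b) := by
  intro x hx y hy hxy
  have := hf.invHazard_antitone ⟨hx.1, hxy.trans_le hy.2⟩ hy hxy.le
  simp only [phiF, virtualValue]
  linarith

theorem phiF_right (hf : IsRegularDensity a b f) : phiF a f b = b := by
  simp [phiF, virtualValue, hf.priorCDF_right]

theorem continuousOn_phiF (hf : IsRegularDensity a b f) : ContinuousOn (phiF a f) (Icc a b) := by
  unfold phiF virtualValue
  refine continuousOn_id.sub fun x hx => ?_
  rcases eq_or_lt_of_le hx.2 with rfl | hxb
  -- At the right end the inverse hazard rate is squeezed between `0` and the bound of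
  -- `invHazard_le` taken at the base point `a`.
  · have ha : 0 < f a := hf.pos a ⟨le_rfl, hf.lt⟩
    have hc : ContinuousOn (fun y => (priorCDF a f (a + (x - y)) - priorCDF a f a) / f a)
        (Icc a x) := by
      refine ContinuousOn.div_const (ContinuousOn.sub ?_ continuousOn_const) _
      refine hf.continuousOn_priorCDF.comp (by fun_prop) fun y hy => ?_
      exact ⟨by linarith [hy.2], by linarith [hy.1]⟩
    have h0 : (1 - priorCDF a f x) / f x = 0 := by simp [hf.priorCDF_right]
    have h1 := (hc x hx).tendsto
    simp only [sub_self, add_zero, zero_div] at h1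
    unfold ContinuousWithinAt
    simp only [h0]
    refine tendsto_of_tendsto_of_tendsto_of_le_of_le' tendsto_const_nhds h1 ?_ ?_
    · filter_upwards [self_mem_nhdsWithin] with y hy
      exact div_nonneg (sub_nonneg.2 (hf.priorCDF_le_one hy)) (hf.nonneg y hy)
    · filter_upwards [self_mem_nhdsWithin] with y hy
      exact hf.invHazard_le ⟨le_rfl, hf.lt⟩ hy hy.1
  · exact (continuousWithinAt_const.sub (hf.continuousOn_priorCDF x hx)).div
      (hf.continuousOn x hx) (hf.pos x ⟨hx.1, hxb⟩).ne'

/-! ### `H_F` and its generalized convex hull -/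

theorem hasDerivAt_mul_one_sub (hf : IsRegularDensity a b f) (c : ℝ) {x : ℝ} (hx : x ∈ Ioo a b) :
    HasDerivAt (fun v => v * (1 - c * priorCDF a f v))
      (-(x * (c * f x) + c * priorCDF a f x - 1)) x := by
  have h := (hasDerivAt_id x).mul
    ((hasDerivAt_const x (1 : ℝ)).sub ((hf.hasDerivAt_priorCDF hx).const_mul c))
  refine h.congr_deriv ?_
  simp
  ring

theorem continuousOn_revCurve (hf : IsRegularDensity a b f) (c : ℝ) :
    ContinuousOn (revCurve a f c) (Icc a b) :=
  continuousOn_id.mul (continuousOn_const.sub (continuousOn_const.mul hf.continuousOn_priorCDF))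

theorem HF_eq (hf : IsRegularDensity a b f) {x : ℝ} (hx : x ∈ Icc a b) :
    HF a f x = -revCurve a f 1 x := by
  have hsub : Icc a x ⊆ Icc a b := Icc_subset_Icc_right hx.2
  have i1 : IntervalIntegrable (fun t => t * f t) volume a x :=
    ContinuousOn.intervalIntegrable_of_Icc hx.1
      (continuousOn_id.mul (hf.continuousOn.mono hsub))
  have i2 : IntervalIntegrable (fun t => 1 - priorCDF a f t) volume a x :=
    ContinuousOn.intervalIntegrable_of_Icc hx.1
      (continuousOn_const.sub (hf.continuousOn_priorCDF.mono hsub))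
  have key := intervalIntegral.integral_eq_sub_of_hasDerivAt_of_le hx.1
    (((hf.continuousOn_revCurve 1).mono hsub).neg) (f' := fun t => t * f t - (1 - priorCDF a f t))
    (fun t ht => by
      refine (hf.hasDerivAt_mul_one_sub 1 ⟨ht.1, ht.2.trans_le hx.2⟩).neg.congr_deriv ?_
      ring) (i1.sub i2)
  rw [intervalIntegral.integral_sub i1 i2] at key
  rw [HF, key]
  simp [revCurve, priorCDF_left]

theorem phiF_mul (hf : IsRegularDensity a b f) {x : ℝ} (hx : x ∈ Ico a b) :
    f x * phiF a f x = x * f x + priorCDF a f x - 1 := by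
  have := (hf.pos x hx).ne'
  simp only [phiF, virtualValue]
  field_simp
  ring

/-- The function `H_F - φ_F(x) F` has derivative `f(t) (φ_F(t) - φ_F(x))`, so it decreases before
`x` and increases after it. This is convexity of `H_F` in the variable `F`, with slope `φ_F`. -/
theorem HF_supporting_line (hf : IsRegularDensity a b f) {x z : ℝ} (hx : x ∈ Icc a b)
    (hz : z ∈ Icc a b) :
    HF a f x + phiF a f x * (priorCDF a f z - priorCDF a f x) ≤ HF a f z := by
  have hd : ∀ t ∈ Ioo a b,
      HasDerivAt (fun z => -revCurve a f 1 z - phiF a f x * priorCDF a f z)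
        (f t * (phiF a f t - phiF a f x)) t := by
    intro t ht
    refine ((hf.hasDerivAt_mul_one_sub 1 ht).neg.sub
      ((hf.hasDerivAt_priorCDF ht).const_mul (phiF a f x))).congr_deriv ?_
    rw [mul_sub, hf.phiF_mul (Ioo_subset_Ico_self ht)]
    ring
  have hc : ContinuousOn (fun z => -revCurve a f 1 z - phiF a f x * priorCDF a f z) (Icc a b) :=
    (hf.continuousOn_revCurve 1).neg.sub (continuousOn_const.mul hf.continuousOn_priorCDF)
  have hmono := hf.phiF_strictMonoOn.monotoneOn
  rw [hf.HF_eq hx, hf.HF_eq hz]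
  rcases le_total x z with h | h
  · have hm : MonotoneOn (fun z => -revCurve a f 1 z - phiF a f x * priorCDF a f z) (Icc x z) := by
      refine monotoneOn_of_deriv_nonneg (convex_Icc x z) (hc.mono (Icc_subset_Icc hx.1 hz.2)) ?_ ?_
      all_goals
        intro t ht
        rw [interior_Icc] at ht
        have ht' : t ∈ Ioo a b := ⟨hx.1.trans_lt ht.1, ht.2.trans_le hz.2⟩
      · exact (hd t ht').differentiableAt.differentiableWithinAt
      · rw [(hd t ht').deriv]
        exact mul_nonneg (hf.nonneg t (Ioo_subset_Icc_self ht'))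
          (sub_nonneg.2 (hmono hx (Ioo_subset_Icc_self ht') ht.1.le))
    have := hm (left_mem_Icc.2 h) (right_mem_Icc.2 h) h
    simp only at this
    linarith
  · have hm : AntitoneOn (fun z => -revCurve a f 1 z - phiF a f x * priorCDF a f z) (Icc z x) := by
      refine antitoneOn_of_deriv_nonpos (convex_Icc z x) (hc.mono (Icc_subset_Icc hz.1 hx.2)) ?_ ?_
      all_goals
        intro t ht
        rw [interior_Icc] at ht
        have ht' : t ∈ Ioo a b := ⟨hz.1.trans_lt ht.1, ht.2.trans_le hx.2⟩
      · exact (hd t ht').differentiableAt.differentiableWithinAt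
      · rw [(hd t ht').deriv]
        exact mul_nonpos_of_nonneg_of_nonpos (hf.nonneg t (Ioo_subset_Icc_self ht'))
          (sub_nonpos.2 (hmono (Ioo_subset_Icc_self ht') hx ht.2.le))
    have := hm (left_mem_Icc.2 h) (right_mem_Icc.2 h) h
    simp only at this
    linarith

theorem PsiF_eq (hf : IsRegularDensity a b f) {x : ℝ} (hx : x ∈ Icc a b) :
    PsiF a b f x = HF a f x := by
  refine IsGreatest.csSup_eq ⟨⟨HF a f x - phiF a f x * priorCDF a f x, phiF a f x,
    fun y hy => ?_, by ring⟩, ?_⟩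
  · have := hf.HF_supporting_line hx hy
    linarith
  · rintro r ⟨α, β, h, rfl⟩
    exact h x hx

/-- Comparing a subgradient at `x` with the supporting line at `z < x` bounds it below by `φ_F(z)`;
then let `z → x`. The point `a` must be excluded: its subgradients are unbounded below, so `sInf`
takes its default value there. -/
theorem ellF_eq (hf : IsRegularDensity a b f) {x : ℝ} (hx : x ∈ Ioc a b) :
    ellF a b f x = phiF a f x := by
  have hx' := Ioc_subset_Icc_self hx
  refine IsLeast.csInf_eq ⟨fun z hz => ?_, fun β hβ => ?_⟩
  · rw [hf.PsiF_eq hx', hf.PsiF_eq hz]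
    exact hf.HF_supporting_line hx' hz
  · have hlt : ∀ z ∈ Ico a x, phiF a f z ≤ β := by
      intro z hz
      have hz' : z ∈ Icc a b := ⟨hz.1, hz.2.le.trans hx.2⟩
      have h1 := hβ z hz'
      rw [hf.PsiF_eq hx', hf.PsiF_eq hz'] at h1
      have h2 := hf.HF_supporting_line hz' hx'
      have h3 := hf.strictMonoOn_priorCDF hz' hx' hz.2
      have : 0 ≤ (β - phiF a f z) * (priorCDF a f x - priorCDF a f z) := by nlinarith
      have := nonneg_of_mul_nonneg_left this (sub_pos.2 h3)
      linarith
    have hcl : x ∈ closure (Ico a x) := by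
      rw [closure_Ico hx.1.ne]; exact right_mem_Icc.2 hx.1.le
    have := mem_closure_iff_nhdsWithin_neBot.1 hcl
    exact le_of_tendsto
      ((hf.continuousOn_phiF x hx').mono
        (Ico_subset_Icc_self.trans (Icc_subset_Icc_right hx.2))).tendsto
      (eventually_of_mem self_mem_nhdsWithin hlt)

theorem mu_eq (hf : IsRegularDensity a b f) (γ : ℝ) {s x : ℝ} (hs : s ∈ Icc a b)
    (hx : x ∈ Ioc a b) :
    mu a b f γ s x = γ * (revCurve a f 1 s - revCurve a f 1 x
      - phiF a f x * (priorCDF a f x - priorCDF a f s)) + (1 - γ) * (s - phiF a f x) := by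
  rw [mu, alphaF, hf.ellF_eq hx, hf.PsiF_eq (Ioc_subset_Icc_self hx), hf.HF_eq hs,
    hf.HF_eq (Ioc_subset_Icc_self hx)]
  ring

/-- Up to terms constant in `x`, the `γ`-part of `μ_s(x)` is the tangent to `H_F` at `x` evaluated
at `F(s)`. By convexity this falls as the point of tangency moves right of `s`; the other part falls
because `φ_F` increases. -/
theorem mu_lt_mu (hf : IsRegularDensity a b f) {γ : ℝ} (hγ0 : 0 < γ) (hγ1 : γ < 1) {s x y : ℝ}
    (hs : s ∈ Icc a b) (hsx : s < x) (hxy : x < y) (hy : y ≤ b) :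
    mu a b f γ s y < mu a b f γ s x := by
  have hx : x ∈ Ioc a b := ⟨hs.1.trans_lt hsx, hxy.le.trans hy⟩
  have hy : y ∈ Ioc a b := ⟨hx.1.trans hxy, hy⟩
  have hx' := Ioc_subset_Icc_self hx
  have hy' := Ioc_subset_Icc_self hy
  rw [hf.mu_eq γ hs hx, hf.mu_eq γ hs hy]
  have h1 := hf.HF_supporting_line hy' hx'
  rw [hf.HF_eq hx', hf.HF_eq hy'] at h1
  have h2 := hf.phiF_strictMonoOn hx' hy' hxy
  have h3 := hf.strictMonoOn_priorCDF hs hx' hsx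
  have h4 : 0 < (1 - γ) * (phiF a f y - phiF a f x) :=
    mul_pos (by linarith) (by linarith)
  have h5 : 0 < (phiF a f y - phiF a f x) * (priorCDF a f x - priorCDF a f s) :=
    mul_pos (by linarith) (by linarith)
  have h6 : 0 < γ * ((revCurve a f 1 s - revCurve a f 1 x
      - phiF a f x * (priorCDF a f x - priorCDF a f s))
      - (revCurve a f 1 s - revCurve a f 1 y
      - phiF a f y * (priorCDF a f y - priorCDF a f s))) :=
    mul_pos hγ0 (by nlinarith)
  linarith

end IsRegularDensity

/-! ### Infima in `[a, b]` with default value `b`. -/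

theorem infOr_mem_Icc {a b : ℝ} (hab : a ≤ b) {S : Set ℝ} (hS : S ⊆ Icc a b) :
    infOr b S ∈ Icc a b := by
  unfold infOr
  split_ifs with h
  · obtain ⟨x, hx⟩ := h
    exact ⟨le_csInf ⟨x, hx⟩ fun y hy => (hS hy).1,
      (csInf_le ⟨a, fun y hy => (hS hy).1⟩ hx).trans (hS hx).2⟩
  · exact right_mem_Icc.2 hab

theorem infOr_le {a b : ℝ} {S : Set ℝ} (hS : S ⊆ Icc a b) {x : ℝ} (hx : x ∈ S) :
    infOr b S ≤ x := by
  rw [infOr, if_pos ⟨x, hx⟩]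
  exact csInf_le ⟨a, fun y hy => (hS hy).1⟩ hx

theorem le_infOr {b c : ℝ} {S : Set ℝ} (hcb : c ≤ b) (h : ∀ x ∈ S, c ≤ x) : c ≤ infOr b S := by
  unfold infOr
  split_ifs with hS
  · exact le_csInf hS h
  · exact hcb

theorem exists_lt_of_infOr_lt {b c : ℝ} {S : Set ℝ} (hcb : c ≤ b) (h : infOr b S < c) :
    ∃ x ∈ S, x < c := by
  by_contra! hS
  exact h.not_ge (le_infOr hcb hS)

theorem infOr_mem_closure {a b : ℝ} {S : Set ℝ} (hS : S ⊆ Icc a b) (h : infOr b S < b) :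
    infOr b S ∈ closure S := by
  obtain ⟨x, hx, -⟩ := exists_lt_of_infOr_lt le_rfl h
  rw [infOr, if_pos ⟨x, hx⟩]
  exact csInf_mem_closure ⟨x, hx⟩ ⟨a, fun y hy => (hS hy).1⟩

/-- The derivative of the revenue curve has the sign of `-marginal`. -/
noncomputable def marginal (a : ℝ) (f : ℝ → ℝ) (γ v : ℝ) : ℝ := v * (γ * f v) + γ * priorCDF a f v - 1

namespace IsRegularDensity

variable {a b γ : ℝ} {f : ℝ → ℝ}

theorem isClosed_nonneg {g : ℝ → ℝ} (hg : ContinuousOn g (Icc a b)) :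
    IsClosed {v | v ∈ Icc a b ∧ 0 ≤ g v} :=
  hg.preimage_isClosed_of_isClosed isClosed_Icc isClosed_Ici

/-! ### The monopoly price of the prior -/

/-- The infimum is attained because `φ_F` is continuous and `φ_F(b) = b ≥ 0` makes the set nonempty.
-/
theorem pIgnore_isLeast (hf : IsRegularDensity a b f) (hb : 0 ≤ b) :
    IsLeast {v | v ∈ Icc a b ∧ 0 ≤ phiF a f v} (pIgnore a b f) := by
  have hne : {v | v ∈ Icc a b ∧ 0 ≤ phiF a f v}.Nonempty :=
    ⟨b, hf.right_mem, by rwa [hf.phiF_right]⟩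
  have hbd : BddBelow {v | v ∈ Icc a b ∧ 0 ≤ phiF a f v} := ⟨a, fun y hy => hy.1.1⟩
  rw [pIgnore, infOr, if_pos hne]
  exact ⟨(isClosed_nonneg hf.continuousOn_phiF).csInf_mem hne hbd, fun y hy => csInf_le hbd hy⟩

theorem phiF_pIgnore (hf : IsRegularDensity a b f) (hb : 0 ≤ b) (h : a < pIgnore a b f) :
    phiF a f (pIgnore a b f) = 0 := by
  have hp := hf.pIgnore_isLeast hb
  refine le_antisymm ?_ hp.1.2
  have hcl : pIgnore a b f ∈ closure (Ico a (pIgnore a b f)) := by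
    rw [closure_Ico h.ne]; exact right_mem_Icc.2 h.le
  have := mem_closure_iff_nhdsWithin_neBot.1 hcl
  refine le_of_tendsto ((hf.continuousOn_phiF _ hp.1.1).mono
    (Ico_subset_Icc_self.trans (Icc_subset_Icc_right hp.1.1.2))).tendsto
    (eventually_of_mem self_mem_nhdsWithin fun z hz => ?_)
  by_contra! hz'
  exact hz.2.not_ge (hp.2 ⟨⟨hz.1, hz.2.le.trans hp.1.1.2⟩, hz'.le⟩)

theorem pIgnore_nonneg (hf : IsRegularDensity a b f) (hb : 0 ≤ b) : 0 ≤ pIgnore a b f := by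
  obtain ⟨⟨hI, h0⟩, -⟩ := hf.pIgnore_isLeast hb
  refine h0.trans ?_
  have := div_nonneg (sub_nonneg.2 (hf.priorCDF_le_one hI)) (hf.nonneg _ hI)
  simp only [phiF, virtualValue]
  linarith

theorem continuousOn_marginal (hf : IsRegularDensity a b f) (γ : ℝ) :
    ContinuousOn (marginal a f γ) (Icc a b) :=
  ((continuousOn_id.mul (continuousOn_const.mul hf.continuousOn)).add
    (continuousOn_const.mul hf.continuousOn_priorCDF)).sub continuousOn_const

theorem revCurve_monotoneOn (hf : IsRegularDensity a b f) {x y : ℝ} (hx : a ≤ x) (hy : y ≤ b)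
    (h : ∀ v ∈ Ioo x y, marginal a f γ v ≤ 0) : MonotoneOn (revCurve a f γ) (Icc x y) := by
  refine monotoneOn_of_deriv_nonneg (convex_Icc x y)
    ((hf.continuousOn_revCurve γ).mono (Icc_subset_Icc hx hy)) ?_ ?_
  all_goals
    intro t ht
    rw [interior_Icc] at ht
    have hd := hf.hasDerivAt_mul_one_sub γ (⟨hx.trans_lt ht.1, ht.2.trans_le hy⟩ : t ∈ Ioo a b)
  · exact hd.differentiableAt.differentiableWithinAt
  · exact hd.deriv ▸ neg_nonneg.2 (h t ht)

theorem revCurve_antitoneOn (hf : IsRegularDensity a b f) {x y : ℝ} (hx : a ≤ x) (hy : y ≤ b)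
    (h : ∀ v ∈ Ioo x y, 0 ≤ marginal a f γ v) : AntitoneOn (revCurve a f γ) (Icc x y) := by
  refine antitoneOn_of_deriv_nonpos (convex_Icc x y)
    ((hf.continuousOn_revCurve γ).mono (Icc_subset_Icc hx hy)) ?_ ?_
  all_goals
    intro t ht
    rw [interior_Icc] at ht
    have hd := hf.hasDerivAt_mul_one_sub γ (⟨hx.trans_lt ht.1, ht.2.trans_le hy⟩ : t ∈ Ioo a b)
  · exact hd.differentiableAt.differentiableWithinAt
  · exact hd.deriv ▸ neg_nonpos.2 (h t ht)

theorem marginal_one (hf : IsRegularDensity a b f) {v : ℝ} (hv : v ∈ Ico a b) :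
    marginal a f 1 v = f v * phiF a f v := by
  rw [hf.phiF_mul hv, marginal]
  ring

theorem marginal_eq (hf : IsRegularDensity a b f) (hγ0 : 0 < γ) {v : ℝ} (hv : v ∈ Ico a b) :
    marginal a f γ v = γ * f v * phiGammaF a f γ v := by
  have := (hf.pos v hv).ne'
  simp only [phiGammaF, virtualValue, marginal]
  field_simp
  ring

theorem marginal_nonneg_iff (hf : IsRegularDensity a b f) (hγ0 : 0 < γ) {v : ℝ}
    (hv : v ∈ Ico a b) : 0 ≤ marginal a f γ v ↔ 0 ≤ phiGammaF a f γ v := by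
  rw [hf.marginal_eq hγ0 hv, mul_nonneg_iff_of_pos_left (mul_pos hγ0 (hf.pos v hv))]

theorem revCurve_one_monotoneOn (hf : IsRegularDensity a b f) (hb : 0 ≤ b) :
    MonotoneOn (revCurve a f 1) (Icc a (pIgnore a b f)) := by
  have hp := hf.pIgnore_isLeast hb
  refine hf.revCurve_monotoneOn le_rfl hp.1.1.2 fun v hv => ?_
  have hv' : v ∈ Ico a b := ⟨hv.1.le, hv.2.trans_le hp.1.1.2⟩
  rw [hf.marginal_one hv']
  refine mul_nonpos_of_nonneg_of_nonpos (hf.pos v hv').le ?_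
  by_contra! h
  exact hv.2.not_ge (hp.2 ⟨Ico_subset_Icc_self hv', h.le⟩)

theorem revCurve_one_antitoneOn (hf : IsRegularDensity a b f) (hb : 0 ≤ b) :
    AntitoneOn (revCurve a f 1) (Icc (pIgnore a b f) b) := by
  have hp := hf.pIgnore_isLeast hb
  refine hf.revCurve_antitoneOn hp.1.1.1 le_rfl fun v hv => ?_
  have hv' : v ∈ Ico a b := ⟨hp.1.1.1.trans hv.1.le, hv.2⟩
  rw [hf.marginal_one hv']
  exact mul_nonneg (hf.pos v hv').le (hp.1.2.trans
    (hf.phiF_strictMonoOn.monotoneOn hp.1.1 (Ico_subset_Icc_self hv') hv.1.le))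

theorem revCurve_one_le_pIgnore (hf : IsRegularDensity a b f) (hb : 0 ≤ b) {v : ℝ}
    (hv : v ∈ Icc a b) : revCurve a f 1 v ≤ revCurve a f 1 (pIgnore a b f) := by
  have hp := (hf.pIgnore_isLeast hb).1.1
  rcases le_total v (pIgnore a b f) with h | h
  · exact hf.revCurve_one_monotoneOn hb ⟨hv.1, h⟩ (right_mem_Icc.2 hp.1) h
  · exact hf.revCurve_one_antitoneOn hb (left_mem_Icc.2 hp.2) ⟨h, hv.2⟩ h

/-- The difference is `(1 - γ) v`, the revenue from the truthful buyer. -/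
theorem mul_revCurve_one_le (hγ1 : γ < 1) {v : ℝ} (hv : 0 ≤ v) :
    γ * revCurve a f 1 v ≤ revCurve a f γ v := by
  simp only [revCurve]
  nlinarith

/-! ### The shape of the revenue curve of `γ F` -/

theorem pos_of_marginal_nonneg (hf : IsRegularDensity a b f) (hγ0 : 0 < γ) (hγ1 : γ < 1) {v : ℝ}
    (hv : v ∈ Icc a b) (h : 0 ≤ marginal a f γ v) : 0 < v := by
  by_contra! hv0
  have h1 := hf.priorCDF_le_one hv
  have h2 := mul_nonneg hγ0.le (hf.nonneg v hv)
  have h3 := mul_nonpos_of_nonpos_of_nonneg hv0 h2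
  simp only [marginal] at h
  nlinarith

/-- The logarithmic derivative `f'/f` is nonincreasing; this is the limit of the difference
quotients in `cross_mul_le`. -/
theorem deriv_mul_le (hf : IsRegularDensity a b f) {x y : ℝ} (hx : x ∈ Ioo a b)
    (hy : y ∈ Ioo a b) (hxy : x ≤ y) : f x * deriv f y ≤ deriv f x * f y := by
  have tx := (hf.differentiableAt hx).hasDerivAt.tendsto_slope_zero_right
  have ty := (hf.differentiableAt hy).hasDerivAt.tendsto_slope_zero_right
  refine le_of_tendsto_of_tendsto (ty.const_mul (f x)) (tx.mul_const (f y)) ?_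
  have hmem : Ioo 0 (b - y) ∈ 𝓝[>] (0 : ℝ) := Ioo_mem_nhdsGT (sub_pos.2 hy.2)
  filter_upwards [hmem] with h hh
  have key := hf.logConcave.cross_mul_le hf.nonneg hxy hh.1.le (Ioo_subset_Icc_self hx)
    (⟨by linarith [hy.1, hh.1], by linarith [hh.2]⟩ : y + h ∈ Icc a b)
  have hi : 0 ≤ h⁻¹ := inv_nonneg.2 hh.1.le
  simp only [smul_eq_mul]
  nlinarith [mul_le_mul_of_nonneg_left key hi]

theorem hasDerivAt_marginal (hf : IsRegularDensity a b f) (γ : ℝ) {x : ℝ} (hx : x ∈ Ioo a b) :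
    HasDerivAt (marginal a f γ) (γ * (2 * f x + x * deriv f x)) x := by
  refine ((((hasDerivAt_id x).mul ((hf.differentiableAt hx).hasDerivAt.const_mul γ)).add
    ((hf.hasDerivAt_priorCDF hx).const_mul γ)).sub_const 1).congr_deriv ?_
  simp
  ring

/-- The derivative of `marginal` is `γ f(v) (2 + v f'(v)/f(v))`. A drop from nonnegative to negative
forces `c f'(c)/f(c) < -2` at some `c > 0`. Since `f'/f` is nonincreasing and negative at `c`, the
inequality persists to the right of `c`, so `marginal` keeps falling. -/
theorem marginal_neg_of_lt (hf : IsRegularDensity a b f) (hγ0 : 0 < γ) (hγ1 : γ < 1) {x y z : ℝ}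
    (hx : x ∈ Icc a b) (hz : z ∈ Icc a b) (hxy : x ≤ y) (hyz : y ≤ z)
    (hgx : 0 ≤ marginal a f γ x) (hgy : marginal a f γ y < 0) : marginal a f γ z < 0 := by
  have hxpos := hf.pos_of_marginal_nonneg hγ0 hγ1 hx hgx
  have hlt : x < y := lt_of_le_of_ne hxy (by rintro rfl; exact hgy.not_ge hgx)
  have hyb : y ≤ b := hyz.trans hz.2
  obtain ⟨c, hc, hcd⟩ := exists_deriv_eq_slope (marginal a f γ) hlt
    ((hf.continuousOn_marginal γ).mono (Icc_subset_Icc hx.1 hyb))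
    fun t ht => (hf.hasDerivAt_marginal γ
      ⟨hx.1.trans_lt ht.1, ht.2.trans_le hyb⟩).differentiableAt.differentiableWithinAt
  have hcm : c ∈ Ioo a b := ⟨hx.1.trans_lt hc.1, hc.2.trans_le hyb⟩
  have hneg : γ * (2 * f c + c * deriv f c) < 0 := by
    rw [← (hf.hasDerivAt_marginal γ hcm).deriv, hcd]
    exact div_neg_of_neg_of_pos (by linarith) (by linarith)
  have hneg' : 2 * f c + c * deriv f c < 0 := by
    by_contra! h
    exact hneg.not_ge (mul_nonneg hγ0.le h)
  have hc0 : 0 < c := hxpos.trans hc.1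
  have hfc := hf.pos c (Ioo_subset_Ico_self hcm)
  have hdc : deriv f c < 0 := by
    by_contra! h
    nlinarith [mul_nonneg hc0.le h]
  have hanti : AntitoneOn (marginal a f γ) (Icc y b) := by
    refine antitoneOn_of_deriv_nonpos (convex_Icc y b)
      ((hf.continuousOn_marginal γ).mono (Icc_subset_Icc_left (hx.1.trans hxy))) ?_ ?_
    all_goals
      intro t ht
      rw [interior_Icc] at ht
      have htm : t ∈ Ioo a b := ⟨hcm.1.trans (hc.2.trans ht.1), ht.2⟩
      have hd := hf.hasDerivAt_marginal γ htm
    · exact hd.differentiableAt.differentiableWithinAt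
    · rw [hd.deriv]
      refine mul_nonpos_of_nonneg_of_nonpos hγ0.le ?_
      have hct : c ≤ t := (hc.2.trans ht.1).le
      have hft := hf.pos t (Ioo_subset_Ico_self htm)
      have h1 := hf.deriv_mul_le hcm htm hct
      have h2 : deriv f t ≤ 0 := by
        by_contra! h
        nlinarith [mul_pos hfc h, mul_neg_of_neg_of_pos hdc hft]
      have h3 : t * deriv f t ≤ c * deriv f t := mul_le_mul_of_nonpos_right hct h2
      have h4 : f c * (2 * f t + c * deriv f t) ≤ 0 := by
        nlinarith [mul_le_mul_of_nonneg_left h1 hc0.le, mul_neg_of_neg_of_pos hneg' hft]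
      have h5 : 2 * f t + c * deriv f t ≤ 0 := by
        by_contra! h
        exact h4.not_gt (mul_pos hfc h)
      linarith
  exact (hanti (left_mem_Icc.2 hyb) ⟨hyz, hz.2⟩ hyz).trans_lt hgy

/-- If `marginal` is negative at `p`, it stays so and the curve rises from `p` to `s`. Otherwise it
was never negative on `[x, p]`, and the curve falls from `x` to `p`. -/
theorem revCurve_le_max (hf : IsRegularDensity a b f) (hγ0 : 0 < γ) (hγ1 : γ < 1) {x p s : ℝ}
    (hx : x ∈ Icc a b) (hs : s ≤ b) (hxp : x ≤ p) (hps : p ≤ s) (hgx : 0 ≤ marginal a f γ x) :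
    revCurve a f γ p ≤ max (revCurve a f γ x) (revCurve a f γ s) := by
  have hpm : p ∈ Icc a b := ⟨hx.1.trans hxp, hps.trans hs⟩
  rcases lt_or_ge (marginal a f γ p) 0 with h | h
  · refine le_max_of_le_right (hf.revCurve_monotoneOn hpm.1 hs (fun v hv => ?_)
      (left_mem_Icc.2 hps) (right_mem_Icc.2 hps) hps)
    exact (hf.marginal_neg_of_lt hγ0 hγ1 hx ⟨hpm.1.trans hv.1.le, hv.2.le.trans hs⟩ hxp hv.1.le
      hgx h).le
  · refine le_max_of_le_left (hf.revCurve_antitoneOn hx.1 hpm.2 (fun v hv => ?_)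
      (left_mem_Icc.2 hxp) (right_mem_Icc.2 hxp) hxp)
    by_contra! hv'
    exact (hf.marginal_neg_of_lt hγ0 hγ1 hx hpm hv.1.le hv.2.le hgx hv').not_ge h

/-! ### The threshold `T_s` -/

theorem pIgnore_le_thresholdT_iff (hf : IsRegularDensity a b f) (hb : 0 ≤ b) (hγ0 : 0 < γ)
    (hγ1 : γ < 1) {s : ℝ} (hs : s ∈ Icc a b) (hsp : s < pIgnore a b f) :
    pIgnore a b f ≤ thresholdT a b f γ s ↔
      γ * revCurve a f 1 (pIgnore a b f) ≤ revCurve a f γ s := by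
  have hp := (hf.pIgnore_isLeast hb).1.1
  have hpa : a < pIgnore a b f := hs.1.trans_lt hsp
  have hφ := hf.phiF_pIgnore hb hpa
  have hsub : {T : ℝ | T ∈ Ioc s b ∧ mu a b f γ s T = 0} ⊆ Icc a b :=
    fun T hT => ⟨hs.1.trans hT.1.1.le, hT.1.2⟩
  have hμ : mu a b f γ s (pIgnore a b f) =
      revCurve a f γ s - γ * revCurve a f 1 (pIgnore a b f) := by
    rw [hf.mu_eq γ hs ⟨hpa, hp.2⟩, hφ]
    simp only [revCurve]
    ring
  constructor
  · intro h
    by_contra! hlt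
    set P := pIgnore a b f with hP
    -- The closed form of `μ_s` is continuous down to `x = s`, whereas `mu` itself involves a
    -- default value there if `s = a`. It is positive at `s` and negative at `P`, so the
    -- intermediate value theorem puts a zero strictly between.
    let m : ℝ → ℝ := fun x => γ * (revCurve a f 1 s - revCurve a f 1 x
      - phiF a f x * (priorCDF a f x - priorCDF a f s)) + (1 - γ) * (s - phiF a f x)
    have hmc : ContinuousOn m (Icc s P) := by
      have hss : Icc s P ⊆ Icc a b := Icc_subset_Icc hs.1 hp.2
      have c1 := (hf.continuousOn_revCurve 1).mono hss
      have c2 := hf.continuousOn_phiF.mono hss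
      have c3 := hf.continuousOn_priorCDF.mono hss
      exact (continuousOn_const.mul ((continuousOn_const.sub c1).sub
        (c2.mul (c3.sub continuousOn_const)))).add
        (continuousOn_const.mul (continuousOn_const.sub c2))
    have hms : 0 < m s := by
      have hsb : s < b := hsp.trans_le hp.2
      have hF := hf.strictMonoOn_priorCDF hs hf.right_mem hsb
      rw [hf.priorCDF_right] at hF
      have : 0 < (1 - priorCDF a f s) / f s := div_pos (by linarith) (hf.pos s ⟨hs.1, hsb⟩)
      have : m s = (1 - γ) * ((1 - priorCDF a f s) / f s) := by
        simp only [m, phiF, virtualValue]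
        ring
      rw [this]
      exact mul_pos (by linarith) ‹_›
    have hmP : m P < 0 := by
      have : m P = mu a b f γ s P := (hf.mu_eq γ hs ⟨hpa, hp.2⟩).symm
      rw [this, hμ]
      linarith
    obtain ⟨T, hT, hT0⟩ := intermediate_value_Ioo' hsp.le hmc ⟨hmP, hms⟩
    have hTb : T ∈ Ioc s b := ⟨hT.1, hT.2.le.trans hp.2⟩
    have : thresholdT a b f γ s ≤ T := infOr_le hsub
      ⟨hTb, by rw [hf.mu_eq γ hs ⟨hs.1.trans_lt hT.1, hTb.2⟩]; exact hT0⟩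
    linarith [hT.2]
  · intro h
    refine le_infOr hp.2 fun T hT => ?_
    by_contra! hlt
    have := hf.mu_lt_mu hγ0 hγ1 hs hT.1.1 hlt hp.2
    rw [hμ, hT.2] at this
    linarith

theorem le_thresholdT {s : ℝ} (hs : s ≤ b) : s ≤ thresholdT a b f γ s :=
  le_infOr hs fun _ hT => hT.1.1.le

/-! ### The regime boundary below which the signal is ignored -/

theorem firstFollow_mem_Icc (hf : IsRegularDensity a b f) (γ : ℝ) :
    firstFollow a b f γ ∈ Icc a b :=
  infOr_mem_Icc hf.lt.le fun _ hs => hs.1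

theorem firstFollow_le_pIgnore (hf : IsRegularDensity a b f) (hb : 0 ≤ b) (γ : ℝ) :
    firstFollow a b f γ ≤ pIgnore a b f :=
  have hp := (hf.pIgnore_isLeast hb).1.1
  infOr_le (fun _ hs => hs.1) ⟨hp, le_thresholdT hp.2⟩

theorem revCurve_lt_of_lt_firstFollow (hf : IsRegularDensity a b f) (hb : 0 ≤ b) (hγ0 : 0 < γ)
    (hγ1 : γ < 1) {s : ℝ} (hs : s ∈ Icc a b) (h : s < firstFollow a b f γ) :
    revCurve a f γ s < γ * revCurve a f 1 (pIgnore a b f) := by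
  have hsp := h.trans_le (hf.firstFollow_le_pIgnore hb γ)
  by_contra! hge
  exact h.not_ge (infOr_le (fun _ hs => hs.1)
    ⟨hs, (hf.pIgnore_le_thresholdT_iff hb hγ0 hγ1 hs hsp).2 hge⟩)

theorem le_revCurve_of_firstFollow_le (hf : IsRegularDensity a b f) (hb : 0 ≤ b) (hγ0 : 0 < γ)
    (hγ1 : γ < 1) (hmono : MonotoneOn (revCurve a f γ) (Icc a (pIgnore a b f))) {s : ℝ}
    (hs : s ∈ Icc a (pIgnore a b f)) (h : firstFollow a b f γ ≤ s) :
    γ * revCurve a f 1 (pIgnore a b f) ≤ revCurve a f γ s := by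
  have hp := (hf.pIgnore_isLeast hb).1.1
  rcases hs.2.eq_or_lt with rfl | hsp
  · exact mul_revCurve_one_le hγ1 (hf.pIgnore_nonneg hb)
  have hsb : s < b := hsp.trans_le hp.2
  have hcl := infOr_mem_closure (b := b) (fun _ hs => hs.1) (h.trans_lt hsb)
  -- The set defining `firstFollow` also contains all points from `pIgnore` on. Truncating at
  -- `pIgnore`, where the inequality holds anyway, puts the whole set inside a closed condition that
  -- passes to its infimum.
  have hclosed : IsClosed {v | v ∈ Icc a b ∧ 0 ≤ revCurve a f γ (min v (pIgnore a b f)) -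
      γ * revCurve a f 1 (pIgnore a b f)} := by
    refine isClosed_nonneg (ContinuousOn.sub ?_ continuousOn_const)
    exact (hf.continuousOn_revCurve γ).comp (by fun_prop)
      fun v hv => ⟨le_min hv.1 hp.1, (min_le_left _ _).trans hv.2⟩
  have hsub : {s : ℝ | s ∈ Icc a b ∧ pIgnore a b f ≤ thresholdT a b f γ s} ⊆
      {v | v ∈ Icc a b ∧ 0 ≤ revCurve a f γ (min v (pIgnore a b f)) -
        γ * revCurve a f 1 (pIgnore a b f)} := by
    rintro v ⟨hv, hvT⟩
    refine ⟨hv, sub_nonneg.2 ?_⟩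
    rcases lt_or_ge v (pIgnore a b f) with hlt | hge
    · rw [min_eq_left hlt.le]
      exact (hf.pIgnore_le_thresholdT_iff hb hγ0 hγ1 hv hlt).1 hvT
    · rw [min_eq_right hge]
      exact mul_revCurve_one_le hγ1 (hf.pIgnore_nonneg hb)
  have hL : 0 ≤ revCurve a f γ (min (firstFollow a b f γ) (pIgnore a b f)) -
      γ * revCurve a f 1 (pIgnore a b f) := (closure_minimal hsub hclosed hcl).2
  rw [min_eq_left (h.trans hs.2)] at hL
  have := hmono ⟨(hf.firstFollow_mem_Icc γ).1, h.trans hs.2⟩ hs h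
  linarith

end IsRegularDensity

/-! ### Revenue of feasible mechanisms -/

/-- Over `n` equal steps the bounds telescope to `(θ - a) / n * (x θ - x a)`, which tends to `0`.
This is an envelope argument that needs no regularity of `x` or `D`. -/
theorem monotone_of_increment_le {x D : ℝ → ℝ} {a θ : ℝ} (haθ : a ≤ θ)
    (h : ∀ y ∈ Icc a θ, ∀ z ∈ Icc a θ, y ≤ z → D z - D y ≤ (z - y) * (x z - x y)) :
    D θ ≤ D a := by
  have hn : ∀ n : ℕ, 0 < n → D θ - D a ≤ (θ - a) / n * (x θ - x a) := by
    intro n hn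
    have hn' : (0 : ℝ) < n := by exact_mod_cast hn
    let g : ℕ → ℝ := fun k => a + k * ((θ - a) / n)
    have hδ : 0 ≤ (θ - a) / n := div_nonneg (by linarith) hn'.le
    have hg0 : g 0 = a := by simp [g]
    have hgn : g n = θ := by simp only [g]; field_simp; ring
    have hgs : ∀ k, g (k + 1) - g k = (θ - a) / n := by
      intro k; simp only [g]; push_cast; ring
    have hgm : Monotone g := monotone_nat_of_le_succ fun k => by linarith [hgs k]
    have hk : ∀ k ≤ n, D (g k) - D a ≤ (θ - a) / n * (x (g k) - x a) := by
      intro k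
      induction k with
      | zero => intro _; simp [hg0]
      | succ k ih =>
        intro hk
        have h1 : ∀ j ≤ n, g j ∈ Icc a θ :=
          fun j hj => ⟨hg0 ▸ hgm (Nat.zero_le j), hgn ▸ hgm hj⟩
        have h2 := h _ (h1 k (by omega)) _ (h1 (k + 1) hk) (hgm (Nat.le_succ k))
        rw [hgs k] at h2
        have h3 := ih (by omega)
        linarith
    simpa [hgn] using hk n le_rfl
  have hlim : Tendsto (fun n : ℕ => (θ - a) / n * (x θ - x a)) atTop (𝓝 0) := by
    simpa using (tendsto_const_div_atTop_nhds_zero_nat (θ - a)).mul_const (x θ - x a)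
  have := ge_of_tendsto hlim (eventually_atTop.2 ⟨1, fun n h1 => hn n h1⟩)
  linarith

theorem Mechanism.FeasibleAt.monotoneOn_alloc {m : Mechanism} {a b s : ℝ}
    (hm : m.FeasibleAt a b s) : MonotoneOn (fun θ => m.alloc θ s) (Icc a b) := by
  intro y hy z hz hyz
  rcases hyz.eq_or_lt with rfl | hlt
  · exact le_rfl
  have h1 := hm.incentive_compatible y hy z hz
  have h2 := hm.incentive_compatible z hz y hy
  simp only [Mechanism.utility] at h1 h2
  by_contra! hc
  nlinarith [mul_pos (sub_pos.2 hlt) (sub_pos.2 hc)]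

/-- The lowest value in `[a, b]` that is allocated the good with probability more than `z`. -/
noncomputable def marginalType (a b : ℝ) (x : ℝ → ℝ) (z : ℝ) : ℝ :=
  infOr b {θ | θ ∈ Icc a b ∧ z < x θ}

/-! ### Superlevel sets of a monotone allocation. -/

section marginalType

variable {a b : ℝ} {x : ℝ → ℝ}

theorem marginalType_mem (hab : a ≤ b) (z : ℝ) : marginalType a b x z ∈ Icc a b :=
  infOr_mem_Icc hab fun _ h => h.1

theorem marginalType_monotone (hab : a ≤ b) : Monotone (marginalType a b x) := fun _ _ hzw =>
  le_infOr (marginalType_mem hab _).2 fun _ hθ =>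
    infOr_le (fun _ h => h.1) ⟨hθ.1, hzw.trans_lt hθ.2⟩

theorem marginalType_le {z θ : ℝ} (hθ : θ ∈ Icc a b) (h : z < x θ) : marginalType a b x z ≤ θ :=
  infOr_le (fun _ h => h.1) ⟨hθ, h⟩

theorem le_marginalType (hx : MonotoneOn x (Icc a b)) {z θ : ℝ} (hθ : θ ∈ Icc a b)
    (h : x θ ≤ z) : θ ≤ marginalType a b x z := by
  refine le_infOr hθ.2 fun θ' hθ' => ?_
  by_contra! hlt
  exact (hθ'.2.trans_le ((hx hθ'.1 hθ hlt.le).trans h)).false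

/-- The closed and half-open cases must be kept apart because the posterior has an atom at the
signal. -/
theorem superlevel_eq (hx : MonotoneOn x (Icc a b)) (z : ℝ) :
    {θ | θ ∈ Icc a b ∧ z < x θ} = ∅ ∨
      {θ | θ ∈ Icc a b ∧ z < x θ} = Icc (marginalType a b x z) b ∨
      {θ | θ ∈ Icc a b ∧ z < x θ} = Ioc (marginalType a b x z) b := by
  rcases Set.eq_empty_or_nonempty {θ | θ ∈ Icc a b ∧ z < x θ} with h | ⟨θ₀, h₀⟩
  · exact Or.inl h
  have hab : a ≤ b := h₀.1.1.trans h₀.1.2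
  have hq := marginalType_mem (x := x) hab z
  have hup : ∀ θ ∈ Ioc (marginalType a b x z) b, θ ∈ {θ | θ ∈ Icc a b ∧ z < x θ} := by
    intro θ hθ
    obtain ⟨θ', hθ', hlt⟩ := exists_lt_of_infOr_lt hθ.2 hθ.1
    have hθm : θ ∈ Icc a b := ⟨hq.1.trans hθ.1.le, hθ.2⟩
    exact ⟨hθm, hθ'.2.trans_le (hx hθ'.1 hθm hlt.le)⟩
  by_cases hmem : z < x (marginalType a b x z)
  · refine Or.inr (Or.inl (Subset.antisymm
      (fun θ hθ => ⟨marginalType_le hθ.1 hθ.2, hθ.1.2⟩) fun θ hθ => ?_))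
    rcases hθ.1.eq_or_lt with rfl | hlt
    · exact ⟨hq, hmem⟩
    · exact hup θ ⟨hlt, hθ.2⟩
  · refine Or.inr (Or.inr (Subset.antisymm (fun θ hθ => ⟨lt_of_le_of_ne
      (marginalType_le hθ.1 hθ.2) ?_, hθ.1.2⟩) hup))
    rintro rfl
    exact hmem hθ.2

end marginalType

/-- The slice of allocation at level `z` can be charged at most the lowest type receiving it.
Incentive compatibility bounds a payment increment by `z (x z - x y)`, while the integral grows by
at least `y (x z - x y)`; the excess is killed by `monotone_of_increment_le`. Individual rationality
at `a` gives the base case. -/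
theorem Mechanism.FeasibleAt.pay_le {m : Mechanism} {a b s : ℝ} (hm : m.FeasibleAt a b s)
    {θ : ℝ} (hθ : θ ∈ Icc a b) :
    m.pay θ s ≤ ∫ z in 0..m.alloc θ s, marginalType a b (fun θ => m.alloc θ s) z := by
  have hab : a ≤ b := hθ.1.trans hθ.2
  set x : ℝ → ℝ := fun θ => m.alloc θ s with hxdef
  have hx : MonotoneOn x (Icc a b) := hm.monotoneOn_alloc
  have hq : Monotone (marginalType a b x) := marginalType_monotone hab
  have hint : ∀ y z, IntervalIntegrable (marginalType a b x) volume y z :=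
    fun y z => hq.intervalIntegrable
  have ha : a ∈ Icc a b := left_mem_Icc.2 hab
  have hbase : m.pay a s ≤ ∫ z in 0..x a, marginalType a b x z := by
    have h1 := hm.individually_rational a ha
    have h2 : ∫ _ in 0..x a, a ≤ ∫ z in 0..x a, marginalType a b x z :=
      intervalIntegral.integral_mono_on (hm.alloc_nonneg a ha) intervalIntegrable_const (hint _ _)
        fun z _ => (marginalType_mem hab z).1
    simp only [Mechanism.utility] at h1
    simp at h2
    have : x a * a = a * m.alloc a s := mul_comm _ _
    linarith
  have key := monotone_of_increment_le (x := x)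
    (D := fun θ => m.pay θ s - ∫ z in 0..x θ, marginalType a b x z) hθ.1 (by
      intro y hy z hz hyz
      have hy' : y ∈ Icc a b := ⟨hy.1, hy.2.trans hθ.2⟩
      have hz' : z ∈ Icc a b := ⟨hz.1, hz.2.trans hθ.2⟩
      have hxyz := hx hy' hz' hyz
      have h1 := hm.incentive_compatible z hz' y hy'
      simp only [Mechanism.utility] at h1
      have h2 : ∫ _ in x y..x z, y ≤ ∫ t in x y..x z, marginalType a b x t :=
        intervalIntegral.integral_mono_on hxyz intervalIntegrable_const (hint _ _)
          fun t ht => le_marginalType hx hy' ht.1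
      simp at h2
      have h3 := intervalIntegral.integral_interval_sub_left (hint 0 (x z)) (hint 0 (x y))
      have e1 : x z = m.alloc z s := rfl
      have e2 : x y = m.alloc y s := rfl
      rw [← e1, ← e2] at h1
      nlinarith)
  linarith

theorem Mechanism.FeasibleAt.integral_pay_le {m : Mechanism} {a b s R : ℝ} (hab : a ≤ b)
    (hm : m.FeasibleAt a b s) (ν : Measure ℝ) [IsFiniteMeasure ν] (hν : ∀ᵐ θ ∂ν, θ ∈ Icc a b)
    (hR : 0 ≤ R) (h1 : ∀ p ∈ Icc a b, p * ν.real (Icc p b) ≤ R)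
    (h2 : ∀ p ∈ Icc a b, p * ν.real (Ioc p b) ≤ R) :
    ∫ θ, m.pay θ s ∂ν ≤ R := by
  -- A non-integrable payment has integral `0` by convention, and `0 ≤ R`.
  by_cases hi : Integrable (fun θ => m.pay θ s) ν
  swap
  · rwa [integral_undef hi]
  have hx : MonotoneOn (fun θ => m.alloc θ s) (Icc a b) := hm.monotoneOn_alloc
  set x : ℝ → ℝ := fun θ => m.alloc θ s with hxdef
  set q := marginalType a b x with hqdef
  have hq : Monotone q := marginalType_monotone hab
  -- The allocation is constrained only on `[a, b]`; extending it through the projection makes it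
  -- monotone, hence measurable, on `ℝ`.
  let X : ℝ → ℝ := fun θ => x (projIcc a b hab θ)
  have hX : Monotone X := fun y z hyz =>
    hx (projIcc a b hab y).2 (projIcc a b hab z).2 (monotone_projIcc hab hyz)
  have hXe : ∀ θ ∈ Icc a b, X θ = x θ := fun θ hθ => by simp [X, projIcc_of_mem hab hθ]
  have hX0 : ∀ θ, 0 ≤ X θ := fun θ => hm.alloc_nonneg _ (projIcc a b hab θ).2
  have hX1 : ∀ θ, X θ ≤ 1 := fun θ => hm.alloc_le_one _ (projIcc a b hab θ).2
  let S : Set (ℝ × ℝ) := {w | w.2 < X w.1}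
  have hS : MeasurableSet S := measurableSet_lt measurable_snd (hX.measurable.comp measurable_fst)
  let k : ℝ → ℝ → ℝ := fun θ z => S.indicator (fun w => q w.2) (θ, z)
  have hkm : Measurable (Function.uncurry k) := by
    have : Function.uncurry k = S.indicator (fun w => q w.2) := by ext ⟨θ, z⟩; rfl
    rw [this]
    exact (hq.measurable.comp measurable_snd).indicator hS
  have hkb : ∀ w, ‖Function.uncurry k w‖ ≤ max |a| |b| := by
    rintro ⟨θ, z⟩
    have hmem := marginalType_mem (x := x) hab z
    refine (norm_indicator_le_norm_self (s := S) (fun w : ℝ × ℝ => q w.2) (θ, z)).trans ?_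
    exact abs_le_max_abs_abs hmem.1 hmem.2
  have hkI : Integrable (Function.uncurry k) (ν.prod (volume.restrict (Ioc (0 : ℝ) 1))) :=
    Integrable.of_bound hkm.aestronglyMeasurable _ (Eventually.of_forall hkb)
  have hJ : ∀ θ, ∫ z in Ioc (0 : ℝ) 1, k θ z = ∫ z in 0..X θ, q z := by
    intro θ
    have hk : k θ = (Iio (X θ)).indicator q := by
      ext z
      by_cases hz : z < X θ
      · rw [indicator_of_mem (by exact hz)]
        exact indicator_of_mem (s := S) (by exact hz) _
      · rw [indicator_of_notMem (by exact hz)]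
        exact indicator_of_notMem (s := S) (by exact hz) _
    rw [hk, setIntegral_indicator measurableSet_Iio, intervalIntegral.integral_of_le (hX0 θ),
      integral_Ioc_eq_integral_Ioo]
    congr 2
    ext z
    simp only [mem_inter_iff, mem_Ioc, mem_Iio, mem_Ioo]
    have := hX1 θ
    constructor
    · rintro ⟨⟨h1, _⟩, h3⟩; exact ⟨h1, h3⟩
    · rintro ⟨h1, h3⟩; exact ⟨⟨h1, h3.le.trans this⟩, h3⟩
  -- For fixed `z` the slice is a posted price: `q z` times the mass of the types above level `z`.
  have hslice : ∀ z, ∫ θ, k θ z ∂ν ≤ R := by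
    intro z
    have hk : (fun θ => k θ z) = {θ | z < X θ}.indicator (fun _ => q z) := by
      ext θ
      by_cases hz : z < X θ
      · rw [indicator_of_mem (by exact hz)]
        exact indicator_of_mem (s := S) (by exact hz) _
      · rw [indicator_of_notMem (by exact hz)]
        exact indicator_of_notMem (s := S) (by exact hz) _
    rw [hk, integral_indicator_const _ (measurableSet_lt measurable_const hX.measurable)]
    have hae : ν.real {θ | z < X θ} = ν.real {θ | θ ∈ Icc a b ∧ z < x θ} := by
      refine measureReal_congr ?_
      filter_upwards [hν] with θ hθ
      refine propext ⟨fun h => ⟨hθ, ?_⟩, fun h => ?_⟩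
      · rw [← hXe θ hθ]; exact h
      · change z < X θ
        rw [hXe θ hθ]; exact h.2
    have hmem := marginalType_mem (x := x) hab z
    rw [hae, smul_eq_mul, mul_comm]
    rcases superlevel_eq hx z with h | h | h <;> rw [h]
    · simpa using hR
    · exact h1 _ hmem
    · exact h2 _ hmem
  calc ∫ θ, m.pay θ s ∂ν
      ≤ ∫ θ, (∫ z in Ioc (0 : ℝ) 1, k θ z) ∂ν := by
        refine integral_mono_ae hi hkI.integral_prod_left ?_
        filter_upwards [hν] with θ hθ
        rw [hJ, hXe θ hθ]
        exact hm.pay_le hθ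
    _ = ∫ z in Ioc (0 : ℝ) 1, ∫ θ, k θ z ∂ν := integral_integral_swap hkI
    _ ≤ ∫ _ in Ioc (0 : ℝ) 1, R :=
        integral_mono hkI.integral_prod_right (integrable_const R) hslice
    _ = R := by simp

theorem postedPrice_feasibleAt (price : ℝ → ℝ) (a b s : ℝ) :
    (postedPrice price).FeasibleAt a b s := by
  constructor
  all_goals
    intro θ _
    simp only [postedPrice, Mechanism.utility]
  · split_ifs <;> norm_num
  · split_ifs <;> norm_num
  · intro θ' _
    split_ifs <;> linarith
  · split_ifs <;> linarith

/-! ### Posterior masses and optimality criteria for a posted price. -/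

namespace IsRegularDensity

variable {a b γ : ℝ} {f : ℝ → ℝ}

theorem prior_apply (hf : IsRegularDensity a b f) {p : ℝ} (hp : p ∈ Icc a b) {A : Set ℝ}
    (hA : MeasurableSet A) (hAp : A ⊆ Icc a b) (hAe : A =ᵐ[volume] Ioc p b) :
    prior a b f A = ENNReal.ofReal (1 - priorCDF a f p) := by
  have hsub : Icc p b ⊆ Icc a b := Icc_subset_Icc_left hp.1
  rw [prior, withDensity_apply _ hA, Measure.restrict_restrict hA,
    inter_eq_self_of_subset_left hAp, setLIntegral_congr hAe,
    ← hf.priorCDF_right, hf.priorCDF_sub hp hf.right_mem, intervalIntegral.integral_of_le hp.2,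
    ofReal_integral_eq_lintegral_ofReal]
  · exact (hf.continuousOn.mono hsub).integrableOn_Icc.mono_set Ioc_subset_Icc_self
  · filter_upwards [self_mem_ae_restrict measurableSet_Ioc] with v hv
    exact hf.nonneg v (hsub (Ioc_subset_Icc_self hv))

theorem prior_univ (hf : IsRegularDensity a b f) : prior a b f univ = 1 := by
  have h : prior a b f univ = prior a b f (Icc a b) := by
    simp only [prior, withDensity_apply _ MeasurableSet.univ,
      withDensity_apply _ measurableSet_Icc, Measure.restrict_restrict measurableSet_Icc,
      Measure.restrict_univ, inter_self]
  rw [h, hf.prior_apply hf.left_mem measurableSet_Icc subset_rfl Ioc_ae_eq_Icc.symm,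
    priorCDF_left]
  simp

theorem isFiniteMeasure_posterior (hf : IsRegularDensity a b f) (γ s : ℝ) :
    IsFiniteMeasure (posterior a b f γ s) := by
  have : IsFiniteMeasure (prior a b f) := ⟨by rw [hf.prior_univ]; exact ENNReal.one_lt_top⟩
  unfold posterior
  have := Measure.smul_finite (prior a b f) (ENNReal.ofReal_ne_top (r := γ))
  have := Measure.smul_finite (Measure.dirac s) (ENNReal.ofReal_ne_top (r := 1 - γ))
  infer_instance

theorem ae_posterior_mem (γ : ℝ) {s : ℝ} (hs : s ∈ Icc a b) :
    ∀ᵐ θ ∂(posterior a b f γ s), θ ∈ Icc a b := by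
  rw [posterior, ae_add_measure_iff]
  refine ⟨Measure.ae_smul_measure ?_ _, Measure.ae_smul_measure ?_ _⟩
  · exact (withDensity_absolutelyContinuous _ _).ae_le (ae_restrict_mem measurableSet_Icc)
  · exact (ae_dirac_iff (p := (· ∈ Icc a b)) measurableSet_Icc).2 hs

open Classical in
theorem posterior_real (hf : IsRegularDensity a b f) (hγ0 : 0 < γ) (hγ1 : γ < 1) (s : ℝ) {p : ℝ}
    (hp : p ∈ Icc a b) {A : Set ℝ} (hA : MeasurableSet A) (hAp : A ⊆ Icc a b)
    (hAe : A =ᵐ[volume] Ioc p b) :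
    (posterior a b f γ s).real A =
      γ * (1 - priorCDF a f p) + (1 - γ) * (if s ∈ A then 1 else 0) := by
  have h1 := sub_nonneg.2 (hf.priorCDF_le_one hp)
  have h2 : 0 ≤ 1 - γ := by linarith
  rw [Measure.real, posterior, Measure.add_apply, Measure.smul_apply, Measure.smul_apply,
    hf.prior_apply hp hA hAp hAe, Measure.dirac_apply' s hA, smul_eq_mul, smul_eq_mul,
    ENNReal.toReal_add, ENNReal.toReal_mul, ENNReal.toReal_mul, ENNReal.toReal_ofReal hγ0.le,
    ENNReal.toReal_ofReal h1, ENNReal.toReal_ofReal h2]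
  · by_cases hs : s ∈ A <;> simp [hs]
  · exact ENNReal.mul_ne_top ENNReal.ofReal_ne_top ENNReal.ofReal_ne_top
  · refine ENNReal.mul_ne_top ENNReal.ofReal_ne_top ?_
    by_cases hs : s ∈ A <;> simp [hs]

/-- No feasible mechanism earns more than the best posted price. -/
theorem revenue_le (hf : IsRegularDensity a b f) (hγ0 : 0 < γ) (hγ1 : γ < 1) {s R : ℝ}
    (hs : s ∈ Icc a b) (hle : ∀ p ∈ Icc a s, revCurve a f γ p ≤ R)
    (hge : ∀ p ∈ Icc s b, γ * revCurve a f 1 p ≤ R) {m : Mechanism} (hm : m.FeasibleAt a b s) :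
    m.revenue a b f γ s ≤ R := by
  have := hf.isFiniteMeasure_posterior γ s
  have hR : 0 ≤ R := by
    have := hge b ⟨hs.2, le_rfl⟩
    simpa [revCurve, hf.priorCDF_right] using this
  have key : ∀ p ∈ Icc a b, ∀ A : Set ℝ, Ioc p b ⊆ A → A ⊆ Icc p b → MeasurableSet A →
      p * (posterior a b f γ s).real A ≤ R := by
    intro p hp A h1 h2 hA
    have hAe : A =ᵐ[volume] Ioc p b := by
      refine EventuallyLE.antisymm ?_ (Eventually.of_forall fun v hv => h1 hv)
      have h3 : A ≤ᵐ[volume] Icc p b := Eventually.of_forall fun v hv => h2 hv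
      exact EventuallyLE.trans h3 Ioc_ae_eq_Icc.symm.le
    rw [hf.posterior_real hγ0 hγ1 s hp hA (h2.trans (Icc_subset_Icc_left hp.1)) hAe]
    split_ifs with hsA
    · have := hle p ⟨hp.1, (h2 hsA).1⟩
      simp only [revCurve] at this
      linarith
    -- Equality can occur, for `A = Ioc s b`: this is the limit of prices just above `s`, which is
    -- why `hge` includes `p = s`.
    · have hsp : s ≤ p := by
        by_contra! h
        exact hsA (h1 ⟨h, hs.2⟩)
      have := hge p ⟨hsp, hp.2⟩
      simp only [revCurve] at this
      linarith
  exact hm.integral_pay_le (hs.1.trans hs.2) _ (ae_posterior_mem γ hs) hR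
    (fun p hp => key p hp _ Ioc_subset_Icc_self subset_rfl measurableSet_Icc)
    (fun p hp => key p hp _ subset_rfl Ioc_subset_Icc_self measurableSet_Ioc)

open Classical in
theorem postedPrice_revenue (hf : IsRegularDensity a b f) (hγ0 : 0 < γ) (hγ1 : γ < 1)
    {price : ℝ → ℝ} {s : ℝ} (hs : s ∈ Icc a b) (hp : price s ∈ Icc a b) :
    (postedPrice price).revenue a b f γ s =
      price s * (γ * (1 - priorCDF a f (price s)) + (1 - γ) * (if price s ≤ s then 1 else 0)) := by
  have := hf.isFiniteMeasure_posterior γ s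
  have h : (postedPrice price).revenue a b f γ s =
      ∫ θ, (Icc (price s) b).indicator (fun _ => price s) θ ∂(posterior a b f γ s) := by
    refine integral_congr_ae ?_
    filter_upwards [ae_posterior_mem γ hs] with θ hθ
    simp [postedPrice, indicator_apply, hθ.2]
  rw [h, integral_indicator_const _ measurableSet_Icc, smul_eq_mul, mul_comm,
    hf.posterior_real hγ0 hγ1 s hp measurableSet_Icc (Icc_subset_Icc_left hp.1) Ioc_ae_eq_Icc.symm]
  simp [hs.2]

theorem optimal_of_price_le (hf : IsRegularDensity a b f) (hγ0 : 0 < γ) (hγ1 : γ < 1)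
    {price : ℝ → ℝ} {s P : ℝ} (hs : s ∈ Icc a b) (hprice : price s = P) (hP : P ∈ Icc a s)
    (hle : ∀ p ∈ Icc a s, revCurve a f γ p ≤ revCurve a f γ P)
    (hge : ∀ p ∈ Icc s b, γ * revCurve a f 1 p ≤ revCurve a f γ P) :
    (postedPrice price).FeasibleAt a b s ∧ ∀ m' : Mechanism, m'.FeasibleAt a b s →
      m'.revenue a b f γ s ≤ (postedPrice price).revenue a b f γ s := by
  subst hprice
  refine ⟨postedPrice_feasibleAt _ _ _ _, fun m' hm' => ?_⟩
  rw [hf.postedPrice_revenue hγ0 hγ1 hs ⟨hP.1, hP.2.trans hs.2⟩, if_pos hP.2]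
  refine (hf.revenue_le hγ0 hγ1 hs hle hge hm').trans_eq ?_
  simp only [revCurve]
  ring

theorem optimal_of_lt_price (hf : IsRegularDensity a b f) (hγ0 : 0 < γ) (hγ1 : γ < 1)
    {price : ℝ → ℝ} {s P : ℝ} (hs : s ∈ Icc a b) (hprice : price s = P) (hP : P ∈ Ioc s b)
    (hle : ∀ p ∈ Icc a s, revCurve a f γ p ≤ γ * revCurve a f 1 P)
    (hge : ∀ p ∈ Icc s b, γ * revCurve a f 1 p ≤ γ * revCurve a f 1 P) :
    (postedPrice price).FeasibleAt a b s ∧ ∀ m' : Mechanism, m'.FeasibleAt a b s →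
      m'.revenue a b f γ s ≤ (postedPrice price).revenue a b f γ s := by
  subst hprice
  refine ⟨postedPrice_feasibleAt _ _ _ _, fun m' hm' => ?_⟩
  rw [hf.postedPrice_revenue hγ0 hγ1 hs ⟨hs.1.trans hP.1.le, hP.2⟩, if_neg hP.1.not_ge]
  refine (hf.revenue_le hγ0 hγ1 hs hle hge hm').trans_eq ?_
  simp only [revCurve]
  ring

end IsRegularDensity

namespace IsRegularDensity

variable {a b γ : ℝ} {f : ℝ → ℝ}

theorem revCurve_left : revCurve a f γ a = a := by simp [revCurve, priorCDF_left]

theorem capEnd_isGreatest (hf : IsRegularDensity a b f) (γ : ℝ) {M : ℝ} (hM : M ∈ Icc a b) :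
    IsGreatest {s | s ∈ Icc a b ∧ revCurve a f γ s ≤ revCurve a f γ M} (capEnd a b f γ M) := by
  have hne : {s | s ∈ Icc a b ∧ revCurve a f γ s ≤ revCurve a f γ M}.Nonempty := ⟨M, hM, le_rfl⟩
  have hbd : BddAbove {s | s ∈ Icc a b ∧ revCurve a f γ s ≤ revCurve a f γ M} :=
    ⟨b, fun _ h => h.1.2⟩
  have hcl : IsClosed {s | s ∈ Icc a b ∧ revCurve a f γ s ≤ revCurve a f γ M} :=
    (hf.continuousOn_revCurve γ).preimage_isClosed_of_isClosed isClosed_Icc isClosed_Iic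
  rw [capEnd, supOr, if_pos hne]
  exact ⟨hcl.csSup_mem hne hbd, fun y hy => le_csSup hbd hy⟩

/-! ### The regime where `φ_{γF}` is negative at the lower end of the support -/

theorem firstNonneg_mem_Icc (hf : IsRegularDensity a b f) (γ : ℝ) :
    firstNonneg a b f γ ∈ Icc a b :=
  infOr_mem_Icc hf.lt.le fun _ h => h.1

theorem marginal_neg_of_lt_firstNonneg (hf : IsRegularDensity a b f) (hγ0 : 0 < γ) {v : ℝ}
    (hv : a ≤ v) (h : v < firstNonneg a b f γ) : marginal a f γ v < 0 := by
  have hv' : v ∈ Ico a b := ⟨hv, h.trans_le (hf.firstNonneg_mem_Icc γ).2⟩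
  by_contra! hge
  exact h.not_ge (infOr_le (fun _ h => h.1)
    ⟨Ico_subset_Icc_self hv', (hf.marginal_nonneg_iff hγ0 hv').1 hge⟩)

/-- The limit is taken in `marginal`, which is continuous on all of `[a, b]`. Staying below `b`
matters: if `f b = 0`, the fraction in `φ_{γF}(b)` is read as `0` and its sign says nothing about
`marginal`. -/
theorem marginal_firstNonneg (hf : IsRegularDensity a b f) (hγ0 : 0 < γ)
    (h : firstNonneg a b f γ < b) : 0 ≤ marginal a f γ (firstNonneg a b f γ) := by
  have hcl : firstNonneg a b f γ ∈ closure {v : ℝ | v ∈ Icc a b ∧ 0 ≤ phiGammaF a f γ v} :=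
    infOr_mem_closure (fun _ h => h.1) h
  have hcl' := mem_closure_iff_nhdsWithin_neBot.1 hcl
  have hM := hf.firstNonneg_mem_Icc γ
  have hsub : {v : ℝ | v ∈ Icc a b ∧ 0 ≤ phiGammaF a f γ v} ⊆ Icc a b := fun v hv => hv.1
  refine ge_of_tendsto ((hf.continuousOn_marginal γ _ hM).mono hsub).tendsto ?_
  filter_upwards [self_mem_nhdsWithin, mem_nhdsWithin_of_mem_nhds (Iio_mem_nhds h)] with v hv hvb
  exact (hf.marginal_nonneg_iff hγ0 ⟨hv.1.1, hvb⟩).2 hv.2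

theorem pIgnore_le_of_marginal_nonneg (hf : IsRegularDensity a b f) (hb : 0 ≤ b) (hγ0 : 0 < γ)
    (hγ1 : γ < 1) {v : ℝ} (hv : v ∈ Ico a b) (h : 0 ≤ marginal a f γ v) :
    pIgnore a b f ≤ v := by
  have hv' := Ico_subset_Icc_self hv
  refine (hf.pIgnore_isLeast hb).2 ⟨hv', ?_⟩
  have hfv := hf.pos v hv
  have hv0 := hf.pos_of_marginal_nonneg hγ0 hγ1 hv' h
  have h1 : 0 ≤ marginal a f 1 v := by
    have h2 : 0 ≤ (1 - γ) * (v * f v + priorCDF a f v) :=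
      mul_nonneg (by linarith) (add_nonneg (mul_pos hv0 hfv).le (hf.priorCDF_nonneg hv'))
    simp only [marginal] at h ⊢
    nlinarith
  rw [hf.marginal_one hv] at h1
  exact nonneg_of_mul_nonneg_right h1 hfv

theorem pIgnore_le_firstNonneg (hf : IsRegularDensity a b f) (hb : 0 ≤ b) (hγ0 : 0 < γ)
    (hγ1 : γ < 1) : pIgnore a b f ≤ firstNonneg a b f γ := by
  have hM := hf.firstNonneg_mem_Icc γ
  rcases hM.2.eq_or_lt with h | h
  · rw [h]; exact (hf.pIgnore_isLeast hb).1.1.2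
  · exact hf.pIgnore_le_of_marginal_nonneg hb hγ0 hγ1 ⟨hM.1, h⟩ (hf.marginal_firstNonneg hγ0 h)

theorem revCurve_le_max_firstNonneg (hf : IsRegularDensity a b f) (hγ0 : 0 < γ) (hγ1 : γ < 1)
    {p s : ℝ} (hs : s ≤ b) (hMp : firstNonneg a b f γ ≤ p) (hps : p ≤ s) :
    revCurve a f γ p ≤ max (revCurve a f γ (firstNonneg a b f γ)) (revCurve a f γ s) := by
  have hM := hf.firstNonneg_mem_Icc γ
  rcases hM.2.eq_or_lt with h | h
  · rw [show p = s by linarith]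
    exact le_max_right _ _
  · exact hf.revCurve_le_max hγ0 hγ1 hM hs hMp hps (hf.marginal_firstNonneg hγ0 h)

/-- `u_γ` increases up to `M`, and `pIgnore ≤ M`. Below `L` the best price above the signal wins;
between `L` and `M` the best price up to `s` is `s` itself. Beyond `M` the contest is between `M`
and `s`, and `U` is the last signal at which `M` does not lose. -/
theorem fourRegimeOptimal_firstNonneg (hf : IsRegularDensity a b f) (hb : 0 ≤ b) (hγ0 : 0 < γ)
    (hγ1 : γ < 1) :
    FourRegimeOptimal a b f γ (pIgnore a b f) (firstNonneg a b f γ) (firstFollow a b f γ)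
      (firstNonneg a b f γ) (capEnd a b f γ (firstNonneg a b f γ)) := by
  have hM := hf.firstNonneg_mem_Icc γ
  have hIM := hf.pIgnore_le_firstNonneg hb hγ0 hγ1
  have hLI := hf.firstFollow_le_pIgnore hb γ
  have hU := hf.capEnd_isGreatest γ hM
  have hp0 := hf.pIgnore_nonneg hb
  have hp := (hf.pIgnore_isLeast hb).1.1
  have hmono : MonotoneOn (revCurve a f γ) (Icc a (firstNonneg a b f γ)) :=
    hf.revCurve_monotoneOn le_rfl hM.2
      fun v hv => (hf.marginal_neg_of_lt_firstNonneg hγ0 hv.1.le hv.2).le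
  have hmax := fun {p s : ℝ} => hf.revCurve_le_max_firstNonneg (p := p) (s := s) hγ0 hγ1
  set M := firstNonneg a b f γ with hMdef
  set L := firstFollow a b f γ with hLdef
  set U := capEnd a b f γ M with hUdef
  set P := pIgnore a b f with hPdef
  have hMU : M ≤ U := hU.2 ⟨hM, le_rfl⟩
  have hanti := hf.revCurve_one_antitoneOn hb
  rw [← hPdef] at hanti
  have habove : ∀ s, P ≤ s → ∀ p ∈ Icc s b, γ * revCurve a f 1 p ≤ revCurve a f γ s := by
    intro s hPs p hps
    refine le_trans ?_ (mul_revCurve_one_le hγ1 (hp0.trans hPs))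
    exact mul_le_mul_of_nonneg_left
      (hanti ⟨hPs, hps.1.trans hps.2⟩ ⟨hPs.trans hps.1, hps.2⟩ hps.1) hγ0.le
  refine ⟨⟨hLI.trans hIM, hMU⟩, fun s hs => ?_⟩
  rcases lt_or_ge s L with hsL | hsL
  · have hsP : s < P := hsL.trans_le hLI
    have hlt := hf.revCurve_lt_of_lt_firstFollow hb hγ0 hγ1 hs hsL
    refine hf.optimal_of_lt_price hγ0 hγ1 hs (P := P) (by simp [fourRegimePrice, hsL])
      ⟨hsP, hp.2⟩ (fun p hps => ?_) fun p hps => ?_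
    · exact (hmono ⟨hps.1, hps.2.trans (hsP.le.trans hIM)⟩ ⟨hs.1, hsP.le.trans hIM⟩ hps.2).trans
        hlt.le
    · exact mul_le_mul_of_nonneg_left
        (hf.revCurve_one_le_pIgnore hb ⟨hs.1.trans hps.1, hps.2⟩) hγ0.le
  rcases lt_or_ge s M with hsM | hsM
  · refine hf.optimal_of_price_le hγ0 hγ1 hs (P := s)
      (by simp [fourRegimePrice, hsL.not_gt, hsM]) ⟨hs.1, le_rfl⟩ (fun p hps => ?_) ?_
    · exact hmono ⟨hps.1, hps.2.trans hsM.le⟩ ⟨hs.1, hsM.le⟩ hps.2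
    · rcases le_total P s with hPs | hPs
      · exact habove s hPs
      · intro p hps
        refine le_trans (mul_le_mul_of_nonneg_left
          (hf.revCurve_one_le_pIgnore hb ⟨hs.1.trans hps.1, hps.2⟩) hγ0.le) ?_
        exact hf.le_revCurve_of_firstFollow_le hb hγ0 hγ1
          (hmono.mono (Icc_subset_Icc_right hIM)) ⟨hs.1, hPs⟩ hsL
  rcases le_or_gt s U with hsU | hsU
  · refine hf.optimal_of_price_le hγ0 hγ1 hs (P := M)
      (by simp [fourRegimePrice, hsL.not_gt, hsM.not_gt, hsU]) ⟨hM.1, hsM⟩ (fun p hps => ?_)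
      fun p hps => habove M hIM p ⟨hsM.trans hps.1, hps.2⟩
    rcases le_total p M with hpM | hpM
    · exact hmono ⟨hps.1, hpM⟩ ⟨hM.1, le_rfl⟩ hpM
    -- The interval is extended to `U` rather than stopped at `s`, because `u_γ(U) ≤ u_γ(M)` is what
    -- the definition of `U` supplies.
    · exact (hmax hU.1.1.2 hpM (hps.2.trans hsU)).trans (max_le le_rfl hU.1.2)
  · have hlt : revCurve a f γ M < revCurve a f γ s := by
      by_contra! h
      exact hsU.not_ge (hU.2 ⟨hs, h⟩)
    refine hf.optimal_of_price_le hγ0 hγ1 hs (P := s)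
      (by simp [fourRegimePrice, hsL.not_gt, hsM.not_gt, hsU.not_ge]) ⟨hs.1, le_rfl⟩
      (fun p hps => ?_) (habove s (hIM.trans hsM))
    rcases le_total p M with hpM | hpM
    · exact (hmono ⟨hps.1, hpM⟩ ⟨hM.1, le_rfl⟩ hpM).trans hlt.le
    · exact (hmax hs.2 hpM hps.2).trans (max_le hlt.le le_rfl)

/-! ### The regime where `φ_{γF}` is nonnegative at the lower end of the support -/

/-- Since `marginal` starts nonnegative, a negative value persists up to `b`. Hence `CGamma` is `b`
as soon as its set is nonempty, and if the set is empty, `u_γ` is antitone. -/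
theorem pCap_cases (hf : IsRegularDensity a b f) (hγ0 : 0 < γ) (hγ1 : γ < 1)
    (h : 0 ≤ phiGammaF a f γ a) :
    (pCap a b f γ = a ∧ ∀ s ∈ Icc a b, revCurve a f γ s ≤ a) ∨
      (pCap a b f γ = b ∧ a ≤ revCurve a f γ b) := by
  have hg : 0 ≤ marginal a f γ a := (hf.marginal_nonneg_iff hγ0 ⟨le_rfl, hf.lt⟩).2 h
  have hC : (CGamma a b f γ = a ∧ ∀ s ∈ Icc a b, revCurve a f γ s ≤ a) ∨
      CGamma a b f γ = b := by
    rcases Set.eq_empty_or_nonempty {v : ℝ | v ∈ Icc a b ∧ phiGammaF a f γ v < 0} with he | hne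
    · refine Or.inl ⟨by rw [CGamma, he]; simp [supOr], fun s hs => ?_⟩
      have hanti : AntitoneOn (revCurve a f γ) (Icc a b) :=
        hf.revCurve_antitoneOn le_rfl le_rfl fun v hv => by
          refine (hf.marginal_nonneg_iff hγ0 (Ioo_subset_Ico_self hv)).2 ?_
          by_contra! hlt
          exact he.subset (⟨Ioo_subset_Icc_self hv, hlt⟩ :
            v ∈ {v : ℝ | v ∈ Icc a b ∧ phiGammaF a f γ v < 0})
      exact (hanti hf.left_mem hs hs.1).trans_eq revCurve_left
    · refine Or.inr ?_
      rw [CGamma, supOr, if_pos hne]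
      have hbd : BddAbove {v : ℝ | v ∈ Icc a b ∧ phiGammaF a f γ v < 0} := ⟨b, fun _ h => h.1.2⟩
      refine le_antisymm (csSup_le hne fun _ h => h.1.2) ?_
      obtain ⟨v, hv⟩ := hne
      by_contra! hlt
      have hvb : v < b := (le_csSup hbd hv).trans_lt hlt
      obtain ⟨w, hw1, hw2⟩ := exists_between hlt
      have hvw : v ≤ w := (le_csSup hbd hv).trans hw1.le
      have hwm : w ∈ Ico a b := ⟨hv.1.1.trans hvw, hw2⟩
      have hgv : marginal a f γ v < 0 := by
        by_contra! h0
        exact hv.2.not_ge ((hf.marginal_nonneg_iff hγ0 ⟨hv.1.1, hvb⟩).1 h0)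
      have hgw := hf.marginal_neg_of_lt hγ0 hγ1 hf.left_mem (Ico_subset_Icc_self hwm) hv.1.1 hvw
        hg hgv
      have hφw : phiGammaF a f γ w < 0 := by
        by_contra! h0
        exact hgw.not_ge ((hf.marginal_nonneg_iff hγ0 hwm).2 h0)
      exact hw1.not_ge (le_csSup hbd ⟨Ico_subset_Icc_self hwm, hφw⟩)
  rw [pCap, if_neg h.not_gt]
  rcases hC with ⟨hC, hle⟩ | hC
  · rw [hC, if_pos le_rfl]
    exact Or.inl ⟨rfl, hle⟩
  · rw [hC, revCurve_left]
    split_ifs with hle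
    · exact Or.inr ⟨rfl, hle⟩
    · refine Or.inl ⟨rfl, fun s hs => ?_⟩
      refine (hf.revCurve_le_max hγ0 hγ1 hf.left_mem le_rfl hs.1 hs.2 hg).trans ?_
      rw [revCurve_left]
      exact max_le le_rfl (not_le.1 hle).le

theorem fourRegimeOptimal_of_phiGammaF_nonneg (hf : IsRegularDensity a b f) (hb : 0 ≤ b)
    (hγ0 : 0 < γ) (hγ1 : γ < 1) (h : 0 ≤ phiGammaF a f γ a) :
    FourRegimeOptimal a b f γ (pIgnore a b f) (pCap a b f γ) (LGamma a b f γ) (pCap a b f γ)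
      (capEnd a b f γ (pCap a b f γ)) := by
  have hg : 0 ≤ marginal a f γ a := (hf.marginal_nonneg_iff hγ0 ⟨le_rfl, hf.lt⟩).2 h
  have ha : 0 < a := hf.pos_of_marginal_nonneg hγ0 hγ1 hf.left_mem hg
  have hP : pIgnore a b f = a := le_antisymm
    (hf.pIgnore_le_of_marginal_nonneg hb hγ0 hγ1 ⟨le_rfl, hf.lt⟩ hg)
    (hf.pIgnore_isLeast hb).1.1.1
  have hanti := hf.revCurve_one_antitoneOn hb
  rw [hP] at hanti
  have habove : ∀ s ∈ Icc a b, ∀ p ∈ Icc s b, γ * revCurve a f 1 p ≤ revCurve a f γ s :=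
    fun s hs p hps => (mul_le_mul_of_nonneg_left (hanti hs ⟨hs.1.trans hps.1, hps.2⟩ hps.1)
      hγ0.le).trans (mul_revCurve_one_le hγ1 (ha.le.trans hs.1))
  have hL : LGamma a b f γ = min (infOr b {v : ℝ | v ∈ Icc a b ∧
      revCurve a f γ a < revCurve a f γ v}) (pCap a b f γ) := by rw [LGamma, if_neg h.not_gt]
  have hLa := (infOr_mem_Icc hf.lt.le (S := {v : ℝ | v ∈ Icc a b ∧
      revCurve a f γ a < revCurve a f γ v}) fun _ h => h.1).1
  rcases hf.pCap_cases hγ0 hγ1 h with ⟨hM, hle⟩ | ⟨hM, hle⟩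
  · rw [hP, hL, hM, min_eq_right hLa]
    have hU := (hf.capEnd_isGreatest γ hf.left_mem).2
    refine ⟨⟨le_rfl, hU ⟨hf.left_mem, le_rfl⟩⟩, fun s hs => ?_⟩
    have hsU : s ≤ capEnd a b f γ a := hU ⟨hs, by rw [revCurve_left]; exact hle s hs⟩
    refine hf.optimal_of_price_le hγ0 hγ1 hs (P := a)
      (by simp [fourRegimePrice, hs.1.not_gt, hsU]) ⟨le_rfl, hs.1⟩ (fun p hps => ?_)
      fun p hps => habove a hf.left_mem p ⟨hs.1.trans hps.1, hps.2⟩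
    rw [revCurve_left]
    exact hle p ⟨hps.1, hps.2.trans hs.2⟩
  · have hLb : LGamma a b f γ ≤ b := by rw [hL, hM]; exact min_le_right _ _
    have hLle : ∀ v ∈ Icc a b, a < revCurve a f γ v → LGamma a b f γ ≤ v := fun v hv hlt => by
      rw [hL]
      exact (min_le_left _ _).trans (infOr_le (fun _ h => h.1) ⟨hv, by rwa [revCurve_left]⟩)
    have hLge : ∀ s, LGamma a b f γ ≤ s → s < b → a ≤ revCurve a f γ s := by
      intro s hsL hsb
      have hlt : infOr b {v : ℝ | v ∈ Icc a b ∧ revCurve a f γ a < revCurve a f γ v} ≤ s := by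
        rw [hL, hM] at hsL
        exact (min_le_iff.1 hsL).resolve_right hsb.not_ge
      rcases hlt.eq_or_lt with heq | hlt
      · have hcl := infOr_mem_closure (b := b) (S := {v : ℝ | v ∈ Icc a b ∧
          revCurve a f γ a < revCurve a f γ v}) (fun _ h => h.1) (heq ▸ hsb)
        have hclosed : IsClosed {v | v ∈ Icc a b ∧ 0 ≤ revCurve a f γ v - a} :=
          isClosed_nonneg ((hf.continuousOn_revCurve γ).sub continuousOn_const)
        have hsub : {v : ℝ | v ∈ Icc a b ∧ revCurve a f γ a < revCurve a f γ v} ⊆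
            {v | v ∈ Icc a b ∧ 0 ≤ revCurve a f γ v - a} := fun v hv =>
          ⟨hv.1, sub_nonneg.2 (revCurve_left.symm.trans_le hv.2.le)⟩
        have := (closure_minimal hsub hclosed hcl).2
        rw [heq] at this
        linarith
      -- Some `v < s` has `a < u_γ(v) ≤ max a (u_γ(s))`, so `u_γ(s)` must be the larger term.
      · obtain ⟨v, hv, hvs⟩ := exists_lt_of_infOr_lt hsb.le hlt
        have h1 := hf.revCurve_le_max hγ0 hγ1 hf.left_mem hsb.le hv.1.1 hvs.le hg
        have h2 := hv.2
        rw [revCurve_left] at h1 h2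
        rcases le_max_iff.1 h1 with h3 | h3 <;> linarith
    have hfollow : ∀ s ∈ Icc a b, a ≤ revCurve a f γ s →
        ∀ p ∈ Icc a s, revCurve a f γ p ≤ revCurve a f γ s := fun s hs has p hps =>
      (hf.revCurve_le_max hγ0 hγ1 hf.left_mem hs.2 hps.1 hps.2 hg).trans
        (max_le (revCurve_left.trans_le has) le_rfl)
    have hU := (hf.capEnd_isGreatest γ hf.right_mem).2 ⟨hf.right_mem, le_rfl⟩
    rw [hP, hM]
    refine ⟨⟨hLb, hU⟩, fun s hs => ?_⟩
    rcases lt_or_ge s (LGamma a b f γ) with hsL | hsL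
    -- Here `pIgnore = a`, so ignoring the signal still sells to the truthful buyer and the
    -- criterion for prices up to `s` applies.
    · refine hf.optimal_of_price_le hγ0 hγ1 hs (P := a) (by simp [fourRegimePrice, hsL])
        ⟨le_rfl, hs.1⟩ (fun p hps => ?_)
        fun p hps => habove a hf.left_mem p ⟨hs.1.trans hps.1, hps.2⟩
      rw [revCurve_left]
      by_contra! hlt
      linarith [hLle p ⟨hps.1, hps.2.trans hs.2⟩ hlt, hps.2]
    rcases hs.2.lt_or_eq with hsb | rfl
    · exact hf.optimal_of_price_le hγ0 hγ1 hs (P := s)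
        (by simp [fourRegimePrice, hsL.not_gt, hsb]) ⟨hs.1, le_rfl⟩
        (hfollow s hs (hLge s hsL hsb)) (habove s hs)
    · exact hf.optimal_of_price_le hγ0 hγ1 hs (P := s)
        (by simp [fourRegimePrice, hsL.not_gt]) ⟨hs.1, le_rfl⟩ (hfollow s hs hle) (habove s hs)

end IsRegularDensity

end HallucinatedSignal

theorem proposition1 (a b γ : ℝ) (f : ℝ → ℝ)
    (hab : a < b) (hb : 0 ≤ b) (hγ0 : 0 < γ) (hγ1 : γ < 1)
    (hpos : ∀ v ∈ Set.Ico a b, 0 < f v)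
    (hsmooth : ContDiffOn ℝ 2 f (Set.Icc a b))
    (hlog : HallucinatedSignal.LogConcaveOn (Set.Icc a b) f)
    (hdens : ∫ v in a..b, f v = 1) :
    (a = 0 →
      HallucinatedSignal.FourRegimeOptimal a b f γ
        (HallucinatedSignal.pIgnore a b f)
        (HallucinatedSignal.firstNonneg a b f γ)
        (HallucinatedSignal.firstFollow a b f γ)
        (HallucinatedSignal.firstNonneg a b f γ)
        (HallucinatedSignal.capEnd a b f γ (HallucinatedSignal.firstNonneg a b f γ))) ∧
    HallucinatedSignal.FourRegimeOptimal a b f γ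
      (HallucinatedSignal.pIgnore a b f)
      (HallucinatedSignal.pCap a b f γ)
      (HallucinatedSignal.LGamma a b f γ)
      (HallucinatedSignal.pCap a b f γ)
      (HallucinatedSignal.capEnd a b f γ (HallucinatedSignal.pCap a b f γ)) := by
  have hf : HallucinatedSignal.IsRegularDensity a b f := ⟨hab, hpos, hsmooth, hlog, hdens⟩
  refine ⟨fun _ => hf.fourRegimeOptimal_firstNonneg hb hγ0 hγ1, ?_⟩
  rcases lt_or_ge (HallucinatedSignal.phiGammaF a f γ a) 0 with h | h
  · rw [HallucinatedSignal.pCap, if_pos h, HallucinatedSignal.LGamma, if_pos h]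
    exact hf.fourRegimeOptimal_firstNonneg hb hγ0 hγ1
  · exact hf.fourRegimeOptimal_of_phiGammaF_nonneg hb hγ0 hγ1 h
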